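/- Let $\theta_0,\beta_0,\delta_0\in\mathbb R$, let $\mathfrak a_0$ be a random variable and let $(\varepsilon_t)_{t\ge1}$, $(u_t)_{t\ge1}$ be real random processes on a common probability space. For $t=1,2,\dots$ let $$y_t=\delta_0+\beta_0a_{t-1}+\varepsilon_t,\qquad a_t=a_{t-1}+\frac{\theta_0}{t}(y_t-a_{t-1}),\qquad a_0=\mathfrak a_0,\qquad z_t=a_{t-1}+u_t .$$ Fix a candidate initial value $\mathfrak a$ (a constant, or any real random variable such as $\mathfrak a_0$), and for a candidate gain $\theta$ let $$a_t(\theta)=a_{t-1}(\theta)+\frac{\theta}{t}\bigl(y_t-a_{t-1}(\theta)\bigr),\qquad a_0(\theta)=\mathfrak a,\qquad Q_n(\theta)=\sum_{t=1}^n\bigl(z_t-a_{t-1}(\theta)\bigr)^2,\qquad D_n(\theta,\theta_0)=Q_n(\theta)-Q_n(\theta_0).$$ Assume the following. (A) $1<\underline\theta<\theta_0<\bar\theta<\infty$ and $\theta_0(1-\beta_0)>1/2$. (B) (a) $(\varepsilon_t)_{t\ge1}$ is a strictly stationary martingale difference sequence with respect to $\mathcal F_t=\sigma(\varepsilon_j:1\le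 j\le t)$ (with $\mathcal F_0$ trivial), with $\mathsf E[\varepsilon_t^4\mid\mathcal F_{t-1}]<\infty$ a.s. and $\mathsf E[\varepsilon_t^2\mid\mathcal F_{t-1}]=\sigma_\varepsilon^2$ a.s. for all $t\ge1$, for a constant $\sigma_\varepsilon^2\in(0,\infty)$. (b) $(u_t)_{t\ge1}$ is a strictly stationary martingale difference sequence with respect to $\mathcal I_t=\sigma(\{u_j:1\le j\le t\}\cup\{a_j:0\le j\le t\})$, with $\mathsf E[u_t^4\mid\mathcal I_{t-1}]<\infty$ a.s. and $\mathsf E[u_t^2\mid\mathcal I_{t-1}]=\sigma_u^2$ a.s. for all $t\ge1$, for a constant $\sigma_u^2\in[0,\infty)$. (c) $\mathfrak a_0$ is independent of $(u_t)_{t\ge1}$ and of $(\varepsilon_t)_{t\ge1}$, and $\mathsf E[\mathfrak a_0^4]<\infty$. Then: a) For each $\theta\in[\underline\theta,\bar\theta]$, $(\ln n)^{-1}D_n(\theta,\theta_0)\to D(\theta,\theta_0):=(\theta-\theta_0)^2d(\theta,\theta_0)$ in probability as $n\to\infty$, where $$d(\theta,\theta_0)=\Bigl(\frac{\sigma_a}{\theta_0}\Bigr)^2\frac{(2(1-\beta_0)\theta_0-1)\theta-((1-\beta_0)\theta_0-1)}{(2\theta-1)(\theta_0(1-\beta_0)+\theta-1)},\qquad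 \sigma_a^2=\frac{\sigma_\varepsilon^2\theta_0^2}{2(1-\beta_0)\theta_0-1};$$ the function $\theta\mapsto D(\theta,\theta_0)$ is continuous on $[\underline\theta,\bar\theta]$ and is uniquely minimized there at $\theta=\theta_0$. b) There are a nonrandom function $h$ with $h(x)\to0$ as $x\to0$, $x\ge 0$, and random variables $L_n$ with $(\ln n)^{-1}L_n=O_p(1)$ such that, for all $n$ and all $\theta_1,\theta_2\in[\underline\theta,\bar\theta]$, $|D_n(\theta_1,\theta_0)-D_n(\theta_2,\theta_0)|\le h(|\theta_1-\theta_2|)L_n$. Consequently, the nonlinear least-squares estimator is weakly consistent: if $\hat\theta_n\in[\underline\theta,\bar\theta]$ minimizes $Q_n$ over $[\underline\theta,\bar\theta]$ for every $n$, then $\hat\theta_n\to\theta_0$ in probability. -/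

import Mathlib

open MeasureTheory ProbabilityTheory Filter Set
open scoped Topology ENNReal

noncomputable section

namespace GainLearning

/-! ### The adaptive learning model -/

/-- The learning recursion `a_t(θ) = a_{t-1}(θ) + (θ / t) (y_t - a_{t-1}(θ))`, `t ≥ 1`, with
`a_0(θ) = a`, driven by the observations `y_1, y_2, …` (the value `y 0` is not used). -/
def learn (y : ℕ → ℝ) (θ a : ℝ) : ℕ → ℝ
  | 0 => a
  | t + 1 => learn y θ a t + θ / ((t : ℝ) + 1) * (y (t + 1) - learn y θ a t)

/-- The data of the model: the true parameters, the true (random) initial value, and the error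
processes `(ε_t)_{t ≥ 1}`, `(u_t)_{t ≥ 1}` (the values at `t = 0` are not used). -/
structure Model (Ω : Type*) where
  /-- true gain parameter -/
  θ₀ : ℝ
  /-- true slope -/
  β₀ : ℝ
  /-- true intercept -/
  δ₀ : ℝ
  /-- true initial value -/
  a₀ : Ω → ℝ
  /-- structural errors -/
  ε : ℕ → Ω → ℝ
  /-- measurement errors -/
  u : ℕ → Ω → ℝ

namespace Model

variable {Ω : Type*} (M : Model Ω)

/-- The true learning process `a_t = a_t(θ₀)`: the solution of
`y_t = δ₀ + β₀ a_{t-1} + ε_t`, `a_t = a_{t-1} + (θ₀ / t) (y_t - a_{t-1})`, started at `a₀`. -/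
def a : ℕ → Ω → ℝ
  | 0 => M.a₀
  | t + 1 => fun ω => a t ω
      + M.θ₀ / ((t : ℝ) + 1) * ((M.δ₀ + M.β₀ * a t ω + M.ε (t + 1) ω) - a t ω)

/-- The outcome `y_t = δ₀ + β₀ a_{t-1} + ε_t`, `t ≥ 1`. -/
def y (t : ℕ) (ω : Ω) : ℝ := M.δ₀ + M.β₀ * M.a (t - 1) ω + M.ε t ω

/-- The noisy observation `z_t = a_{t-1} + u_t`, `t ≥ 1`. -/
def z (t : ℕ) (ω : Ω) : ℝ := M.a (t - 1) ω + M.u t ω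

/-- The true process is the learning recursion at the true gain and the true initial value. -/
theorem a_eq_learn (t : ℕ) (ω : Ω) :
    M.a t ω = learn (fun s => M.y s ω) M.θ₀ (M.a₀ ω) t := by
  induction t with
  | zero => rfl
  | succ t ih => rw [learn, ← ih, a, y, Nat.add_sub_cancel]

/-- The least-squares criterion `Q_n(θ) = ∑_{t=1}^n (z_t - a_{t-1}(θ))²`, where `a_t(θ)` is
computed from `y_1, …, y_t` and the candidate initial value `ini`. -/
def Q (ini : Ω → ℝ) (n : ℕ) (θ : ℝ) (ω : Ω) : ℝ :=
  ∑ t ∈ Finset.Icc 1 n, (M.z t ω - learn (fun s => M.y s ω) θ (ini ω) (t - 1)) ^ 2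

/-- `D_n(θ, θ₀) = Q_n(θ) - Q_n(θ₀)`. -/
def Dn (ini : Ω → ℝ) (n : ℕ) (θ : ℝ) (ω : Ω) : ℝ := M.Q ini n θ ω - M.Q ini n M.θ₀ ω

/-- `ℱ_t = σ(ε_j : 1 ≤ j ≤ t)`. -/
def F (t : ℕ) : MeasurableSpace Ω :=
  ⨆ j ∈ Icc 1 t, MeasurableSpace.comap (M.ε j) inferInstance

/-- `ℐ_t = σ(u_j, a_j : j ≤ t)`; the index starts at `1` for `u` and at `0` for `a`. -/
def I (t : ℕ) : MeasurableSpace Ω :=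
  (⨆ j ∈ Icc 1 t, MeasurableSpace.comap (M.u j) inferInstance) ⊔
    ⨆ j ∈ Icc 0 t, MeasurableSpace.comap (M.a j) inferInstance

end Model

/-! ### Probabilistic notions -/

/-- Strict stationarity of `(X_t)_{t ≥ 1}`: every shift has the same law as the process. -/
def IsStationary {Ω : Type*} [MeasurableSpace Ω] (μ : Measure Ω) (X : ℕ → Ω → ℝ) : Prop :=
  ∀ k : ℕ, IdentDistrib (fun ω (t : ℕ) => X (t + 1 + k) ω) (fun ω (t : ℕ) => X (t + 1) ω) μ μ

/-- `(X_t, 𝒢_t)_{t ≥ 1}` (with `𝒢_0` as initial σ-algebra) is a martingale difference sequence. -/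
structure IsMDS {Ω : Type*} [mΩ : MeasurableSpace Ω] (μ : Measure Ω) (X : ℕ → Ω → ℝ)
    (G : ℕ → MeasurableSpace Ω) : Prop where
  le : ∀ t, G t ≤ mΩ
  mono : Monotone G
  adapted : ∀ t, 1 ≤ t → Measurable[G t] (X t)
  integrable : ∀ t, 1 ≤ t → Integrable (X t) μ
  condExp_eq_zero : ∀ t, 1 ≤ t → μ[X t | G (t - 1)] =ᵐ[μ] 0

/-- The conditions imposed on an error process: a stationary martingale difference sequence with
almost surely finite conditional fourth moments (conditional expectation of a `[0, ∞]`-valued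
variable) and constant conditional variance `σ ^ 2`. -/
structure ErrorCondition {Ω : Type*} [MeasurableSpace Ω] (μ : Measure Ω) (X : ℕ → Ω → ℝ)
    (G : ℕ → MeasurableSpace Ω) (σ : ℝ) : Prop where
  stationary : IsStationary μ X
  mds : IsMDS μ X G
  fourth : ∀ t, 1 ≤ t →
    ∀ᵐ ω ∂μ, condLExp (G (t - 1)) μ (fun ω' => ENNReal.ofReal (X t ω' ^ 4)) ω < ∞
  sq_integrable : ∀ t, 1 ≤ t → Integrable (fun ω => X t ω ^ 2) μ
  condVar : ∀ t, 1 ≤ t → μ[fun ω => X t ω ^ 2 | G (t - 1)] =ᵐ[μ] fun _ => σ ^ 2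

/-- The initial value has a finite fourth moment and is independent of `(u_t)_{t ≥ 1}` and of
`(ε_t)_{t ≥ 1}`. -/
structure InitialCondition {Ω : Type*} [MeasurableSpace Ω] (μ : Measure Ω) (M : Model Ω) :
    Prop where
  measurable : Measurable M.a₀
  fourth : Integrable (fun ω => M.a₀ ω ^ 4) μ
  indep_u : IndepFun M.a₀ (fun ω (t : ℕ) => M.u (t + 1) ω) μ
  indep_ε : IndepFun M.a₀ (fun ω (t : ℕ) => M.ε (t + 1) ω) μ

/-- `X_n = O_p(1)`. -/
def IsBigOpOne {Ω : Type*} [MeasurableSpace Ω] (μ : Measure Ω) (X : ℕ → Ω → ℝ) : Prop :=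
  ∀ η : ℝ, 0 < η → ∃ K : ℝ, ∀ᶠ n in atTop, μ {ω | K < |X n ω|} ≤ ENNReal.ofReal η

/-! ### The limit criterion -/

/-- `σ_a² = σ_ε² θ₀² / (2 (1 - β₀) θ₀ - 1)`. -/
def sigmaASq (σε θ₀ β₀ : ℝ) : ℝ := σε ^ 2 * θ₀ ^ 2 / (2 * (1 - β₀) * θ₀ - 1)

/-- The function `d(θ, θ₀)`. -/
def d (σε β₀ θ θ₀ : ℝ) : ℝ :=
  sigmaASq σε θ₀ β₀ / θ₀ ^ 2 *
    (((2 * (1 - β₀) * θ₀ - 1) * θ - ((1 - β₀) * θ₀ - 1)) /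
      ((2 * θ - 1) * (θ₀ * (1 - β₀) + θ - 1)))

/-- The limit criterion `D(θ, θ₀) = (θ - θ₀)² d(θ, θ₀)`. -/
def D (σε β₀ θ θ₀ : ℝ) : ℝ := (θ - θ₀) ^ 2 * d σε β₀ θ θ₀

end GainLearning

end

namespace GainLearning

/-! ### Deterministic first-order recursions with gain `θ / t` -/

/-! Centred at its equilibrium δ₀/(1-β₀), the true path x_t obeys a linear recursion with gain c =
θ₀(1-β₀) > 1/2 and noise θ₀ε_{t+1}. Put l = (θ₀-θ)/θ₀. Subtracting l·x_t from the tracking error a_t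
- a_t(θ) cancels the noise exactly: the rest p_t obeys a recursion with gain θ driven by k·x_t, k =
-θl. Up to a term free of θ, the criterion is ∑ w_t² + 2 ∑ u_{t+1} w_t with w = l·x + p.

Pointwise limit. Started at zero, x and p have second moments O(1/t), so the martingale ∑ u_{t+1}
w_t has variance O(ln n) and vanishes after division by ln n. Telescoping t·x_t², t·x_t·p_t and
t·p_t² gives, up to o(ln n) in L¹, a triangular system: (2c-1)∑x² ≈ θ₀²σ_ε² H_n, (c+θ-1)∑xp ≈ k∑x²,
(2θ-1)∑p² ≈ 2k∑xp, where H_n is the harmonic number. Solving it yields D(θ, θ₀); see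
`ErrorCondition.smallL1_tracking_sq`.

Initial values. The candidate start is merely measurable and may depend on all the errors, so its
effect is neither integrable nor adapted. It is bounded pathwise by a fixed random factor times
quantities that are o(ln n) in probability (`exists_abs_excess_add_sub_le`).

Uniformity in θ. Abel summation moves the errors u into the tail sums R_t = ∑_{t≤j<n} u_{j+1}/(j+1),
which do not involve θ and satisfy E∑R_t² = σ_u² H_n. What they multiply is controlled in ℓ² by a
Hardy inequality, uniformly in θ (`exists_sum_sq_le`, `exists_sq_sum_mul_le`). This makes the
criterion Lipschitz with constant O_p(ln n) (`exists_abs_excess_sub_le`). Consistency then follows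
from a finite net on the compact set of gains away from θ₀ (`tendstoInMeasure_argmin`). -/

lemma add_one_mul_sq_step (θ p f : ℝ) {t : ℝ} (ht : 0 ≤ t) :
    (t + 1) * ((1 - θ / (t + 1)) * p + f / (t + 1)) ^ 2 =
      t * p ^ 2 + (1 - 2 * θ + θ ^ 2 / (t + 1)) * p ^ 2
        + 2 * ((1 - θ / (t + 1)) * (p * f)) + f ^ 2 / (t + 1) := by
  have : t + 1 ≠ 0 := by positivity
  field_simp
  ring

lemma abs_one_sub_div_le {θ B t : ℝ} (hθ : 0 ≤ θ) (hB : θ ≤ B) (ht : 0 ≤ t) :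
    |1 - θ / (t + 1)| ≤ 1 + B := by
  have h1 : 0 ≤ θ / (t + 1) := by positivity
  have h2 : θ / (t + 1) ≤ θ := div_le_self hθ (by linarith)
  rw [abs_le]
  constructor <;> linarith

lemma sq_one_sub_div_le {θ B t : ℝ} (hθ : 0 ≤ θ) (hB : θ ≤ B) (ht : 0 ≤ t) :
    (1 - θ / (t + 1)) ^ 2 ≤ (1 + B) ^ 2 := by
  rw [← sq_abs]
  exact pow_le_pow_left₀ (abs_nonneg _) (abs_one_sub_div_le hθ hB ht) 2

/-- One step of the Lyapunov function t·p_t². With δ = 2b-1, the linear drift 1-2θ is at most -δ;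
the θ²/(t+1) correction costs δ/4 once t is large, Young's inequality for the cross term costs
another δ/4, and -δ/2 survives. -/
lemma add_one_mul_sq_step_le {b B θ t : ℝ} (hb : 1 / 2 < b) (hθ : θ ∈ Icc b B) (p f : ℝ)
    (ht : 0 ≤ t) (htB : 4 * B ^ 2 / (2 * b - 1) ≤ t + 1) :
    (t + 1) * ((1 - θ / (t + 1)) * p + f / (t + 1)) ^ 2 ≤
      t * p ^ 2 - (2 * b - 1) / 2 * p ^ 2
        + (4 / (2 * b - 1) * (1 + B) ^ 2 + 1) * f ^ 2 := by
  obtain ⟨h1, h2⟩ := hθ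
  have hδ : 0 < 2 * b - 1 := by linarith
  rw [add_one_mul_sq_step θ p f ht]
  set δ := 2 * b - 1 with hδdef
  set g := 1 - θ / (t + 1) with hg
  have hg2 : g ^ 2 ≤ (1 + B) ^ 2 := sq_one_sub_div_le (by linarith) h2 ht
  have hB : θ ^ 2 / (t + 1) ≤ δ / 4 := by
    rw [div_le_iff₀ (by positivity)]
    rw [div_le_iff₀ hδ] at htB
    nlinarith
  have hyoung : 2 * (g * (p * f)) ≤ δ / 4 * p ^ 2 + 4 / δ * (g ^ 2 * f ^ 2) := by
    have h := sq_nonneg (δ / 2 * p - 2 * (g * f))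
    have : δ / 4 * p ^ 2 + 4 / δ * (g ^ 2 * f ^ 2) - 2 * (g * (p * f)) =
        (δ / 2 * p - 2 * (g * f)) ^ 2 / δ := by
      field_simp
      ring
    have : 0 ≤ (δ / 2 * p - 2 * (g * f)) ^ 2 / δ := by positivity
    linarith
  have hf : f ^ 2 / (t + 1) ≤ f ^ 2 := div_le_self (sq_nonneg f) (by linarith)
  have h3 : (1 - 2 * θ + θ ^ 2 / (t + 1)) * p ^ 2 ≤ (-δ + δ / 4) * p ^ 2 := by
    gcongr
    linarith
  have h4 : 4 / δ * (g ^ 2 * f ^ 2) ≤ 4 / δ * ((1 + B) ^ 2 * f ^ 2) := by gcongr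
  linarith

/-- Crude exponential growth, needed only for the finitely many times before the Lyapunov
contraction sets in. -/
lemma sq_le_pow_mul {b B θ : ℝ} (hb : 1 / 2 < b) (hθ : θ ∈ Icc b B) {p f : ℕ → ℝ}
    (hp : ∀ t : ℕ, p (t + 1) = (1 - θ / ((t : ℝ) + 1)) * p t + f t / ((t : ℝ) + 1)) (t : ℕ) :
    p t ^ 2 ≤ (2 * (1 + B) ^ 2) ^ t * (p 0 ^ 2 + ∑ s ∈ Finset.range t, f s ^ 2) := by
  obtain ⟨h1, h2⟩ := hθ
  induction t with
  | zero => simp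
  | succ t ih =>
    have ht : (0 : ℝ) ≤ t := t.cast_nonneg
    have hg : (1 - θ / ((t : ℝ) + 1)) ^ 2 ≤ (1 + B) ^ 2 :=
      sq_one_sub_div_le (by linarith) h2 ht
    have hf : (f t / ((t : ℝ) + 1)) ^ 2 ≤ f t ^ 2 := by
      rw [div_pow]
      exact div_le_self (sq_nonneg _) (by nlinarith)
    have hM : 1 ≤ 2 * (1 + B) ^ 2 := by nlinarith
    have hMt : 1 ≤ (2 * (1 + B) ^ 2) ^ t := one_le_pow₀ hM
    have h3 : p (t + 1) ^ 2 ≤ 2 * (1 + B) ^ 2 * p t ^ 2 + 2 * f t ^ 2 := by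
      rw [hp t]
      have := add_sq_le (a := (1 - θ / ((t : ℝ) + 1)) * p t) (b := f t / ((t : ℝ) + 1))
      have h5 : ((1 - θ / ((t : ℝ) + 1)) * p t) ^ 2 ≤ (1 + B) ^ 2 * p t ^ 2 := by
        rw [mul_pow]; gcongr
      linarith
    have h4 : 2 * f t ^ 2 ≤ (2 * (1 + B) ^ 2) ^ (t + 1) * f t ^ 2 := by
      gcongr
      rw [pow_succ]
      nlinarith
    have h5 : 2 * (1 + B) ^ 2 * p t ^ 2 ≤ 2 * (1 + B) ^ 2 *
        ((2 * (1 + B) ^ 2) ^ t * (p 0 ^ 2 + ∑ s ∈ Finset.range t, f s ^ 2)) := by gcongr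
    rw [Finset.sum_range_succ, ← add_assoc, mul_add]
    calc _ ≤ _ := h3
      _ ≤ _ := add_le_add h5 h4
      _ = _ := by rw [pow_succ]; ring

/-- A discrete Hardy inequality for the recursion with gain `θ / t`, uniform in `θ`. -/
lemma exists_sum_sq_le {b B : ℝ} (hb : 1 / 2 < b) :
    ∃ C : ℝ, 0 ≤ C ∧ ∀ θ ∈ Icc b B, ∀ p f : ℕ → ℝ,
      (∀ t : ℕ, p (t + 1) = (1 - θ / ((t : ℝ) + 1)) * p t + f t / ((t : ℝ) + 1)) →
      ∀ n : ℕ, ∑ t ∈ Finset.range n, p t ^ 2 ≤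
        C * (p 0 ^ 2 + ∑ t ∈ Finset.range n, f t ^ 2) := by
  have hδ : 0 < 2 * b - 1 := by linarith
  obtain ⟨T, hT⟩ := exists_nat_ge (4 * B ^ 2 / (2 * b - 1))
  set δ := 2 * b - 1 with hδdef
  set M := 2 * (1 + B) ^ 2 + 1 with hM
  set C₁ := 4 / δ * (1 + B) ^ 2 + 1 with hC₁
  -- Before time T every p_t² is at most M^T·S. The summand T pays for the boundary quantity
  -- (t+1)·p_{t+1}² and δ for the term δ/2·p_t².
  set C₂ := (T + δ) * M ^ T with hC₂
  have hM1 : 1 ≤ M := by nlinarith [sq_nonneg (1 + B)]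
  have hM0 : 0 ≤ M := by linarith
  have hC₁0 : 0 ≤ C₁ := by positivity
  have hC₂0 : 0 ≤ C₂ := by positivity
  refine ⟨2 / δ * (C₁ + T * C₂), by positivity, fun θ hθ p f hp n => ?_⟩
  set S := p 0 ^ 2 + ∑ t ∈ Finset.range n, f t ^ 2 with hS
  have hS0 : 0 ≤ S := by positivity
  -- The differences of t·p_t² telescope, leaving δ/2·∑p_t² bounded by the forcing plus at most T
  -- exceptional charges C₂·S.
  have hstep : ∀ t < n, ((t + 1 : ℕ) : ℝ) * p (t + 1) ^ 2 - t * p t ^ 2 + δ / 2 * p t ^ 2 ≤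
      C₁ * f t ^ 2 + if t < T then C₂ * S else 0 := by
    intro t htn
    have ht0 : (0 : ℝ) ≤ t := t.cast_nonneg
    split_ifs with htT
    · have hcrude : ∀ s ≤ T, s ≤ n → p s ^ 2 ≤ M ^ T * S := by
        intro s hsT hsn
        refine (sq_le_pow_mul hb hθ hp s).trans ?_
        have e1 : (2 * (1 + B) ^ 2) ^ s ≤ M ^ T :=
          (pow_le_pow_left₀ (by positivity) (by linarith) s).trans (pow_le_pow_right₀ hM1 hsT)
        have e2 : ∑ r ∈ Finset.range s, f r ^ 2 ≤ ∑ r ∈ Finset.range n, f r ^ 2 :=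
          Finset.sum_le_sum_of_subset_of_nonneg (Finset.range_mono hsn)
            fun _ _ _ => sq_nonneg _
        exact mul_le_mul e1 (by linarith) (by positivity) (by positivity)
      have h1 := hcrude (t + 1) htT htn
      have h2 := hcrude t htT.le htn.le
      have h3 : ((t + 1 : ℕ) : ℝ) * p (t + 1) ^ 2 ≤ T * (M ^ T * S) := by
        have : ((t + 1 : ℕ) : ℝ) ≤ T := by exact_mod_cast htT
        gcongr
      have h4 : δ / 2 * p t ^ 2 ≤ δ * (M ^ T * S) := by
        have : 0 ≤ M ^ T * S := by positivity
        nlinarith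
      have h5 : 0 ≤ (t : ℝ) * p t ^ 2 := by positivity
      have h6 : 0 ≤ C₁ * f t ^ 2 := by positivity
      have : C₂ * S = T * (M ^ T * S) + δ * (M ^ T * S) := by rw [hC₂]; ring
      linarith
    · have hTt : (T : ℝ) ≤ t := by exact_mod_cast not_lt.1 htT
      have := add_one_mul_sq_step_le hb hθ (p t) (f t) ht0 (by linarith)
      rw [← hp t] at this
      push_cast
      linarith
  have hsum := Finset.sum_le_sum fun t ht => hstep t (Finset.mem_range.1 ht)
  rw [Finset.sum_add_distrib, Finset.sum_range_sub (fun t : ℕ => (t : ℝ) * p t ^ 2),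
    Finset.sum_add_distrib, ← Finset.mul_sum, ← Finset.mul_sum] at hsum
  have hite : ∑ t ∈ Finset.range n, (if t < T then C₂ * S else 0) ≤ T * (C₂ * S) := by
    rw [← Finset.sum_filter, Finset.sum_const, nsmul_eq_mul]
    have : (Finset.range n |>.filter (· < T)).card ≤ T := by
      calc _ ≤ (Finset.range T).card := Finset.card_le_card fun t ht => by
            simp only [Finset.mem_filter] at ht; exact Finset.mem_range.2 ht.2
        _ = T := Finset.card_range T
    gcongr
  have hf : C₁ * ∑ t ∈ Finset.range n, f t ^ 2 ≤ C₁ * S := by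
    gcongr
    rw [hS]
    linarith [sq_nonneg (p 0)]
  have hn : 0 ≤ (n : ℝ) * p n ^ 2 := by positivity
  have hfin : δ / 2 * ∑ t ∈ Finset.range n, p t ^ 2 ≤ (C₁ + T * C₂) * S := by
    simp only [Nat.cast_zero, zero_mul, sub_zero] at hsum
    linarith
  calc ∑ t ∈ Finset.range n, p t ^ 2 = 2 / δ * (δ / 2 * ∑ t ∈ Finset.range n, p t ^ 2) := by
        field_simp
    _ ≤ 2 / δ * ((C₁ + T * C₂) * S) := by gcongr
    _ = _ := by ring

/-- A nonnegative sequence that contracts at rate `δ / t` up to an error `O(1 / t ^ 2)` after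
multiplication by `t` is `O(1 / t)`. -/
lemma exists_le_div_add_one {m : ℕ → ℝ} (hm : ∀ t, 0 ≤ m t) {δ K : ℝ} (hδ : 0 < δ) (hK : 0 ≤ K)
    {T : ℕ} (h : ∀ t : ℕ, T ≤ t →
      ((t : ℝ) + 1) * m (t + 1) ≤ t * m t - δ * m t + K / ((t : ℝ) + 1)) :
    ∃ C : ℝ, 0 ≤ C ∧ ∀ t : ℕ, m t ≤ C / ((t : ℝ) + 1) := by
  obtain ⟨N₀, hN₀⟩ := exists_nat_ge δ
  set N := max T (N₀ + 1) with hN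
  -- The first summand starts the induction; the second ensures K ≤ δ·C₀, so the contraction absorbs
  -- the error. N exceeds δ so that the factor (t-δ)/t stays nonnegative.
  set C₀ := N * m N + K / δ with hC₀
  have hC₀0 : 0 ≤ C₀ := by have := hm N; positivity
  have key : ∀ t, N ≤ t → (t : ℝ) * m t ≤ C₀ := by
    intro t ht
    induction t, ht using Nat.le_induction with
    | base => have : 0 ≤ K / δ := by positivity
              linarith
    | succ t ht ih =>
      have h1 := h t ((le_max_left _ _).trans ht)
      have ht1 : N₀ + 1 ≤ t := (le_max_right _ _).trans ht
      have ht2 : (N₀ : ℝ) + 1 ≤ t := by exact_mod_cast ht1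
      have ht0 : (0 : ℝ) < t := by linarith
      have hCK : K ≤ δ * C₀ := by
        have : δ * (K / δ) = K := by field_simp
        have := hm N
        have : 0 ≤ δ * (N * m N) := by positivity
        rw [hC₀]; linarith
      have h2 : (t : ℝ) * m t - δ * m t ≤ C₀ - δ * C₀ / t := by
        have : (t - δ) / t * (t * m t) ≤ (t - δ) / t * C₀ := by
          have : 0 ≤ (t - δ) / t := div_nonneg (by linarith) ht0.le
          gcongr
        have e1 : (t - δ) / t * (t * m t) = t * m t - δ * m t := by field_simp
        have e2 : (t - δ) / t * C₀ = C₀ - δ * C₀ / t := by field_simp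
        linarith
      have h3 : K / ((t : ℝ) + 1) ≤ δ * C₀ / t := by
        apply div_le_div₀ (by positivity) hCK ht0 (by linarith)
      push_cast
      linarith
  -- For late times t+1 ≤ 2t turns the bound on t·m_t into one on (t+1)·m_t; the finite sum covers
  -- the times up to N.
  refine ⟨2 * C₀ + ∑ s ∈ Finset.range (N + 1), ((s : ℝ) + 1) * m s, ?_, fun t => ?_⟩
  · have : 0 ≤ ∑ s ∈ Finset.range (N + 1), ((s : ℝ) + 1) * m s :=
      Finset.sum_nonneg fun s _ => mul_nonneg (by positivity) (hm s)
    linarith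
  · rw [le_div_iff₀ (by positivity)]
    by_cases ht : t < N + 1
    · have := Finset.single_le_sum (f := fun s : ℕ => ((s : ℝ) + 1) * m s)
        (fun s _ => mul_nonneg (by positivity) (hm s)) (Finset.mem_range.2 ht)
      linarith
    · have h1 := key t (by omega)
      have h2 : (1 : ℝ) ≤ t := by
        have : 1 ≤ t := by omega
        exact_mod_cast this
      have h3 : 0 ≤ ∑ s ∈ Finset.range (N + 1), ((s : ℝ) + 1) * m s :=
        Finset.sum_nonneg fun s _ => mul_nonneg (by positivity) (hm s)
      nlinarith [hm t]

/-- The weighted tail sum `∑_{t ≤ j < n} u_{j+1} / (j+1)`. -/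
noncomputable def tailSum (u : ℕ → ℝ) (n t : ℕ) : ℝ :=
  ∑ j ∈ Finset.Ico t n, u (j + 1) / ((j : ℝ) + 1)

lemma tailSum_eq_add (u : ℕ → ℝ) {n t : ℕ} (h : t < n) :
    tailSum u n t = u (t + 1) / ((t : ℝ) + 1) + tailSum u n (t + 1) := by
  rw [tailSum, Finset.sum_eq_sum_Ico_succ_bot h, tailSum]

/-- Abel summation against the tail sums. -/
lemma sum_mul_eq_sum_tailSum (u p : ℕ → ℝ) (n : ℕ) :
    ∑ t ∈ Finset.range n, u (t + 1) * p t =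
      ∑ t ∈ Finset.range n, tailSum u n t * (((t : ℝ) + 1) * p t - t * p (t - 1)) := by
  -- The summation range k varies while the end n of the tails stays fixed; the boundary term
  -- disappears at k = n because that tail is empty. At t = 0 the truncated index t-1 is harmless,
  -- being multiplied by 0.
  have key : ∀ k ≤ n, ∑ t ∈ Finset.range k, u (t + 1) * p t =
      ∑ t ∈ Finset.range k, tailSum u n t * (((t : ℝ) + 1) * p t - t * p (t - 1))
        - k * p (k - 1) * tailSum u n k := by
    intro k hk
    induction k with
    | zero => simp
    | succ k ih =>
      have hk0 : (k : ℝ) + 1 ≠ 0 := by positivity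
      have e : u (k + 1) = ((k : ℝ) + 1) * (tailSum u n k - tailSum u n (k + 1)) := by
        rw [tailSum_eq_add u (by omega : k < n)]
        field_simp
        ring
      rw [Finset.sum_range_succ, Finset.sum_range_succ, ih (by omega), e]
      push_cast
      ring
  have := key n le_rfl
  simpa [tailSum] using this

/-- After Abel summation and Cauchy–Schwarz, only the increments (t+2)p_{t+1} - (t+1)p_t = p_{t+1} -
θp_t + f_t matter, and the Hardy inequality bounds them in ℓ². The bound is pathwise: p may depend
on u and θ in any way. -/
lemma exists_sq_sum_mul_le {b B : ℝ} (hb : 1 / 2 < b) :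
    ∃ C : ℝ, 0 ≤ C ∧ ∀ θ ∈ Icc b B, ∀ p f : ℕ → ℝ,
      (∀ t : ℕ, p (t + 1) = (1 - θ / ((t : ℝ) + 1)) * p t + f t / ((t : ℝ) + 1)) →
      ∀ (u : ℕ → ℝ) (n : ℕ), (∑ t ∈ Finset.range n, u (t + 1) * p t) ^ 2 ≤
        (∑ t ∈ Finset.range n, tailSum u n t ^ 2) *
          (C * (p 0 ^ 2 + ∑ t ∈ Finset.range n, f t ^ 2)) := by
  obtain ⟨C, hC0, hC⟩ := exists_sum_sq_le (B := B) hb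
  refine ⟨3 * C + 3 * B ^ 2 * C + 3, by positivity, fun θ hθ p f hp u n => ?_⟩
  rw [sum_mul_eq_sum_tailSum]
  refine (Finset.sum_mul_sq_le_sq_mul_sq _ _ _).trans ?_
  refine mul_le_mul_of_nonneg_left ?_ (Finset.sum_nonneg fun _ _ => sq_nonneg _)
  set S := p 0 ^ 2 + ∑ t ∈ Finset.range n, f t ^ 2 with hS
  have hpS : ∑ t ∈ Finset.range n, p t ^ 2 ≤ C * S := hC θ hθ p f hp n
  cases n with
  | zero =>
    simp only [Finset.range_zero, Finset.sum_empty]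
    positivity
  | succ k =>
    -- The term t = 0 is split off; it equals p_0² and is the only one where the index t-1 is
    -- truncated.
    rw [Finset.sum_range_succ']
    have hstep : ∀ t : ℕ, (((t + 1 : ℕ) : ℝ) + 1) * p (t + 1) - ((t + 1 : ℕ) : ℝ) * p t =
        p (t + 1) - θ * p t + f t := by
      intro t
      have : (t : ℝ) + 1 ≠ 0 := by positivity
      rw [hp t]
      push_cast
      field_simp
      ring
    have hB : θ ^ 2 ≤ B ^ 2 := pow_le_pow_left₀ (by linarith [hθ.1]) hθ.2 2
    have hle : ∀ t : ℕ, ((((t + 1 : ℕ) : ℝ) + 1) * p (t + 1) - ((t + 1 : ℕ) : ℝ) * p t) ^ 2 ≤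
        3 * p (t + 1) ^ 2 + 3 * B ^ 2 * p t ^ 2 + 3 * f t ^ 2 := by
      intro t
      rw [hstep]
      have h1 : θ ^ 2 * p t ^ 2 ≤ B ^ 2 * p t ^ 2 := by gcongr
      nlinarith [sq_nonneg (p (t + 1) + θ * p t), sq_nonneg (p (t + 1) - f t),
        sq_nonneg (θ * p t + f t)]
    have h1 := Finset.sum_le_sum fun t (_ : t ∈ Finset.range k) => hle t
    rw [Finset.sum_add_distrib, Finset.sum_add_distrib, ← Finset.mul_sum, ← Finset.mul_sum,
      ← Finset.mul_sum] at h1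
    have h2 := Finset.sum_range_succ' (fun t => p t ^ 2) k
    have h3 := Finset.sum_range_succ (fun t => p t ^ 2) k
    have h4 := Finset.sum_range_succ (fun t => f t ^ 2) k
    have h5 : ∑ t ∈ Finset.range k, p (t + 1) ^ 2 ≤ C * S := by linarith [sq_nonneg (p 0)]
    have h6 : ∑ t ∈ Finset.range k, p t ^ 2 ≤ C * S := by linarith [sq_nonneg (p k)]
    have h7 : p 0 ^ 2 + ∑ t ∈ Finset.range k, f t ^ 2 ≤ S := by
      rw [hS]; linarith [sq_nonneg (f k)]
    have h8 : 3 * B ^ 2 * ∑ t ∈ Finset.range k, p t ^ 2 ≤ 3 * B ^ 2 * (C * S) := by gcongr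
    have h9 := Finset.sum_nonneg fun t (_ : t ∈ Finset.range k) => sq_nonneg (f t)
    simp only [Nat.add_sub_cancel, Nat.cast_zero, zero_mul, zero_add, sub_zero, one_mul]
    nlinarith [sq_nonneg (p 0)]

/-- The excess `∑ ((w_t + u_{t+1})² - u_{t+1}²)` of the criterion due to the tracking error `w`. -/
noncomputable def excess (u w : ℕ → ℝ) (n : ℕ) : ℝ :=
  ∑ t ∈ Finset.range n, w t ^ 2 + 2 * ∑ t ∈ Finset.range n, u (t + 1) * w t

/-- The random part of the Lipschitz constant of the criterion. -/
noncomputable def envelope (u x : ℕ → ℝ) (w₀ : ℝ) (n : ℕ) : ℝ :=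
  w₀ ^ 2 + x 0 ^ 2 + ∑ t ∈ Finset.range n, x t ^ 2 + ∑ t ∈ Finset.range n, tailSum u n t ^ 2
    + |∑ t ∈ Finset.range n, u (t + 1) * x t|

lemma sum_add_sq_le (f g : ℕ → ℝ) (n : ℕ) :
    ∑ t ∈ Finset.range n, (f t + g t) ^ 2 ≤
      2 * ∑ t ∈ Finset.range n, f t ^ 2 + 2 * ∑ t ∈ Finset.range n, g t ^ 2 := by
  rw [Finset.mul_sum, Finset.mul_sum, ← Finset.sum_add_distrib]
  refine Finset.sum_le_sum fun t _ => ?_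
  linarith [add_sq_le (a := f t) (b := g t)]

lemma abs_le_of_sq_le_mul {a b c : ℝ} (hb : 0 ≤ b) (hc : 0 ≤ c) (h : a ^ 2 ≤ b * c) :
    |a| ≤ b + c := by
  apply abs_le_of_sq_le_sq _ (by positivity)
  nlinarith

set_option maxHeartbeats 1000000 in
/-- The excess criterion is Lipschitz in the gain, with constant proportional to `envelope`. -/
lemma exists_abs_excess_sub_le {lo hi θ₀ : ℝ} (hlo : 1 < lo) (hθ₀ : θ₀ ∈ Ioo lo hi) :
    ∃ C : ℝ, 0 ≤ C ∧ ∀ (u x : ℕ → ℝ) (w₀ : ℝ) (p : ℝ → ℕ → ℝ),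
      (∀ θ, p θ 0 = w₀ - (θ₀ - θ) / θ₀ * x 0) →
      (∀ θ, ∀ t : ℕ, p θ (t + 1) = (1 - θ / ((t : ℝ) + 1)) * p θ t
        + -(θ * ((θ₀ - θ) / θ₀)) * x t / ((t : ℝ) + 1)) →
      ∀ n : ℕ, ∀ θ₁ ∈ Icc lo hi, ∀ θ₂ ∈ Icc lo hi,
        |excess u (fun t => (θ₀ - θ₁) / θ₀ * x t + p θ₁ t) n
          - excess u (fun t => (θ₀ - θ₂) / θ₀ * x t + p θ₂ t) n| ≤
        |θ₁ - θ₂| * (C * envelope u x w₀ n) := by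
  obtain ⟨hθl, hθh⟩ := hθ₀
  have hθ₀1 : 1 < θ₀ := hlo.trans hθl
  have hθ₀0 : 0 < θ₀ := by linarith
  have hb : 1 / 2 < lo := by linarith
  have hhi : 1 < hi := hθ₀1.trans hθh
  obtain ⟨H, hH0, hH⟩ := exists_sum_sq_le (B := hi) hb
  obtain ⟨A, hA0, hA⟩ := exists_sq_sum_mul_le (B := hi) hb
  -- constants: `∑ p² ≤ G * W`, `q 0 ^ 2 + ∑ f² ≤ Δ² * (F * W)`
  set G := H * (2 + 2 * hi ^ 2 + hi ^ 4) with hG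
  set F := 1 + 2 * G + 2 * (3 * hi) ^ 2 with hF
  refine ⟨(2 + 2 * H * F) + 2 * (2 * (2 * hi ^ 2 + 2 * G)) + 2 + 2 * (1 + A * F),
    by positivity, fun u x w₀ p hp0 hp n θ₁ h₁ θ₂ h₂ => ?_⟩
  set l : ℝ → ℝ := fun θ => (θ₀ - θ) / θ₀ with hl
  have hp0' : ∀ θ, p θ 0 = w₀ - l θ * x 0 := hp0
  have hp' : ∀ θ, ∀ t : ℕ, p θ (t + 1) = (1 - θ / ((t : ℝ) + 1)) * p θ t
        + -(θ * l θ) * x t / ((t : ℝ) + 1) := hp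
  set X := ∑ t ∈ Finset.range n, x t ^ 2 with hX
  set R := ∑ t ∈ Finset.range n, tailSum u n t ^ 2 with hR
  set Y := |∑ t ∈ Finset.range n, u (t + 1) * x t| with hY
  have hX0 : 0 ≤ X := Finset.sum_nonneg fun _ _ => sq_nonneg _
  have hR0 : 0 ≤ R := Finset.sum_nonneg fun _ _ => sq_nonneg _
  have hY0 : 0 ≤ Y := abs_nonneg _
  set W := w₀ ^ 2 + x 0 ^ 2 + X with hW
  have hW0 : 0 ≤ W := by positivity
  have hXW : X ≤ W := by rw [hW]; linarith [sq_nonneg w₀, sq_nonneg (x 0)]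
  have hlabs : ∀ θ ∈ Icc lo hi, l θ ^ 2 ≤ hi ^ 2 := by
    rintro θ ⟨ha, hb'⟩
    apply sq_le_sq'
    · rw [hl]; simp only; rw [le_div_iff₀ hθ₀0]; nlinarith
    · rw [hl]; simp only; rw [div_le_iff₀ hθ₀0]; nlinarith
  have hP : ∀ θ ∈ Icc lo hi, ∑ t ∈ Finset.range n, p θ t ^ 2 ≤ G * W := by
    intro θ hθ
    refine (hH θ hθ (p θ) (fun t => -(θ * l θ) * x t) (hp' θ) n).trans ?_
    rw [hG, mul_assoc]
    refine mul_le_mul_of_nonneg_left ?_ hH0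
    have e1 : p θ 0 ^ 2 ≤ 2 * w₀ ^ 2 + 2 * (hi ^ 2 * x 0 ^ 2) := by
      rw [hp0' θ]
      have h3 : l θ ^ 2 * x 0 ^ 2 ≤ hi ^ 2 * x 0 ^ 2 :=
        mul_le_mul_of_nonneg_right (hlabs θ hθ) (sq_nonneg _)
      nlinarith [sq_nonneg (w₀ + l θ * x 0)]
    have e2 : ∑ t ∈ Finset.range n, (-(θ * l θ) * x t) ^ 2 ≤ hi ^ 4 * X := by
      simp_rw [mul_pow]
      rw [← Finset.mul_sum]
      refine mul_le_mul_of_nonneg_right ?_ hX0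
      have h3 : θ ^ 2 ≤ hi ^ 2 := pow_le_pow_left₀ (by linarith [hθ.1]) hθ.2 2
      calc (-(θ * l θ)) ^ 2 = θ ^ 2 * l θ ^ 2 := by ring
        _ ≤ hi ^ 2 * hi ^ 2 := mul_le_mul h3 (hlabs θ hθ) (sq_nonneg _) (sq_nonneg _)
        _ = hi ^ 4 := by ring
    have e3 : 0 ≤ hi ^ 2 * (w₀ ^ 2) := by positivity
    have e4 : 0 ≤ hi ^ 4 * (w₀ ^ 2 + x 0 ^ 2) := by positivity
    have e5 : 0 ≤ hi ^ 2 * X := by positivity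
    rw [hW]
    linarith [sq_nonneg (x 0), sq_nonneg w₀]
  set Δ := |θ₁ - θ₂| with hΔ
  have hΔ0 : 0 ≤ Δ := abs_nonneg _
  have hldiff : (l θ₁ - l θ₂) ^ 2 ≤ Δ ^ 2 := by
    have : l θ₁ - l θ₂ = (θ₂ - θ₁) / θ₀ := by rw [hl]; field_simp; ring
    rw [this, hΔ, sq_abs, div_pow]
    have h3 : (θ₂ - θ₁) ^ 2 = (θ₁ - θ₂) ^ 2 := by ring
    rw [h3]
    exact div_le_self (sq_nonneg _) (by nlinarith)
  have hθldiff : (θ₁ * l θ₁ - θ₂ * l θ₂) ^ 2 ≤ Δ ^ 2 * (3 * hi) ^ 2 := by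
    have : θ₁ * l θ₁ - θ₂ * l θ₂ = (θ₁ - θ₂) * ((θ₀ - θ₁ - θ₂) / θ₀) := by
      rw [hl]; field_simp; ring
    rw [this, mul_pow, hΔ, sq_abs]
    refine mul_le_mul_of_nonneg_left ?_ (sq_nonneg _)
    apply sq_le_sq'
    · rw [le_div_iff₀ hθ₀0]; nlinarith [h₁.1, h₁.2, h₂.1, h₂.2]
    · rw [div_le_iff₀ hθ₀0]; nlinarith [h₁.1, h₁.2, h₂.1, h₂.2]
  -- The difference of two drifts again solves a recursion with gain θ₁; replacing θ₂ by θ₁ as gain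
  -- puts (θ₂-θ₁)·p_{θ₂} into the forcing, which is therefore of size Δ.
  set q : ℕ → ℝ := fun t => p θ₁ t - p θ₂ t with hq
  set f : ℕ → ℝ := fun t => (θ₂ - θ₁) * p θ₂ t + -(θ₁ * l θ₁ - θ₂ * l θ₂) * x t with hf
  have hqrec : ∀ t : ℕ, q (t + 1) = (1 - θ₁ / ((t : ℝ) + 1)) * q t + f t / ((t : ℝ) + 1) := by
    intro t
    simp only [hq, hf, hp' θ₁, hp' θ₂]
    ring
  have hdrive : q 0 ^ 2 + ∑ t ∈ Finset.range n, f t ^ 2 ≤ Δ ^ 2 * (F * W) := by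
    have e1 : q 0 ^ 2 ≤ Δ ^ 2 * W := by
      have : q 0 ^ 2 = (l θ₁ - l θ₂) ^ 2 * x 0 ^ 2 := by
        simp only [hq, hp0']; ring
      rw [this]
      exact mul_le_mul hldiff (by rw [hW]; linarith [sq_nonneg w₀]) (sq_nonneg _) (sq_nonneg _)
    have e2 := sum_add_sq_le (fun t => (θ₂ - θ₁) * p θ₂ t)
      (fun t => -(θ₁ * l θ₁ - θ₂ * l θ₂) * x t) n
    have e3 : ∑ t ∈ Finset.range n, ((θ₂ - θ₁) * p θ₂ t) ^ 2 ≤ Δ ^ 2 * (G * W) := by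
      simp_rw [mul_pow]
      rw [← Finset.mul_sum]
      have : (θ₂ - θ₁) ^ 2 = Δ ^ 2 := by rw [hΔ, sq_abs]; ring
      rw [this]
      exact mul_le_mul_of_nonneg_left (hP θ₂ h₂) (sq_nonneg _)
    have e4 : ∑ t ∈ Finset.range n, (-(θ₁ * l θ₁ - θ₂ * l θ₂) * x t) ^ 2 ≤
        Δ ^ 2 * (3 * hi) ^ 2 * W := by
      have h3 : ∀ t, (-(θ₁ * l θ₁ - θ₂ * l θ₂) * x t) ^ 2 =
          (θ₁ * l θ₁ - θ₂ * l θ₂) ^ 2 * x t ^ 2 := fun t => by ring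
      simp_rw [h3]
      rw [← Finset.mul_sum]
      exact mul_le_mul hθldiff hXW hX0 (by positivity)
    have e5 : Δ ^ 2 * (F * W) = Δ ^ 2 * W + 2 * (Δ ^ 2 * (G * W))
        + 2 * (Δ ^ 2 * (3 * hi) ^ 2 * W) := by rw [hF]; ring
    rw [e5]
    linarith
  have hqsum : ∑ t ∈ Finset.range n, q t ^ 2 ≤ Δ ^ 2 * (H * F * W) := by
    refine (hH θ₁ h₁ q f hqrec n).trans ?_
    calc _ ≤ H * (Δ ^ 2 * (F * W)) := mul_le_mul_of_nonneg_left hdrive hH0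
      _ = _ := by ring
  -- The factor Δ² of the Abel bound is shared equally between the tail sums and the energy, so the
  -- arithmetic–geometric inequality gives a bound linear in Δ.
  have huq : |∑ t ∈ Finset.range n, u (t + 1) * q t| ≤ Δ * (R + A * F * W) := by
    have h3 := hA θ₁ h₁ q f hqrec u n
    have h4 : (∑ t ∈ Finset.range n, u (t + 1) * q t) ^ 2 ≤ (Δ * R) * (Δ * (A * F * W)) := by
      refine h3.trans ?_
      calc R * (A * (q 0 ^ 2 + ∑ t ∈ Finset.range n, f t ^ 2))
          ≤ R * (A * (Δ ^ 2 * (F * W))) := by gcongr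
        _ = _ := by ring
    have := abs_le_of_sq_le_mul (by positivity) (by positivity) h4
    linarith
  set w : ℝ → ℕ → ℝ := fun θ t => l θ * x t + p θ t with hw
  have hdiff : ∀ t, w θ₁ t - w θ₂ t = (l θ₁ - l θ₂) * x t + q t := by
    intro t; simp only [hw, hq]; ring
  have hwd : ∑ t ∈ Finset.range n, (w θ₁ t - w θ₂ t) ^ 2 ≤ Δ ^ 2 * ((2 + 2 * H * F) * W) := by
    simp_rw [hdiff]
    have e1 := sum_add_sq_le (fun t => (l θ₁ - l θ₂) * x t) q n
    have e2 : ∑ t ∈ Finset.range n, ((l θ₁ - l θ₂) * x t) ^ 2 ≤ Δ ^ 2 * W := by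
      simp_rw [mul_pow]
      rw [← Finset.mul_sum]
      exact mul_le_mul hldiff hXW hX0
        (sq_nonneg _)
    linarith
  have hw2 : ∀ θ ∈ Icc lo hi, ∑ t ∈ Finset.range n, w θ t ^ 2 ≤ (2 * hi ^ 2 + 2 * G) * W := by
    intro θ hθ
    have e1 := sum_add_sq_le (fun t => l θ * x t) (p θ) n
    have e2 : ∑ t ∈ Finset.range n, (l θ * x t) ^ 2 ≤ hi ^ 2 * W := by
      simp_rw [mul_pow]
      rw [← Finset.mul_sum]
      exact mul_le_mul (hlabs θ hθ) hXW hX0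
        (sq_nonneg _)
    have e3 := hP θ hθ
    simp only [hw]
    linarith
  have hws : ∑ t ∈ Finset.range n, (w θ₁ t + w θ₂ t) ^ 2 ≤
      2 * (2 * (2 * hi ^ 2 + 2 * G)) * W := by
    have e1 := sum_add_sq_le (w θ₁) (w θ₂) n
    have e2 := hw2 θ₁ h₁
    have e3 := hw2 θ₂ h₂
    linarith
  have hprod : |∑ t ∈ Finset.range n, (w θ₁ t - w θ₂ t) * (w θ₁ t + w θ₂ t)| ≤
      Δ * ((2 + 2 * H * F) * W + 2 * (2 * (2 * hi ^ 2 + 2 * G)) * W) := by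
    have h4 : (∑ t ∈ Finset.range n, (w θ₁ t - w θ₂ t) * (w θ₁ t + w θ₂ t)) ^ 2 ≤
        (Δ * ((2 + 2 * H * F) * W)) * (Δ * (2 * (2 * (2 * hi ^ 2 + 2 * G)) * W)) := by
      refine (Finset.sum_mul_sq_le_sq_mul_sq _ _ _).trans ?_
      calc _ ≤ (Δ ^ 2 * ((2 + 2 * H * F) * W)) * (2 * (2 * (2 * hi ^ 2 + 2 * G)) * W) :=
            mul_le_mul hwd hws (Finset.sum_nonneg fun _ _ => sq_nonneg _) (by positivity)
        _ = _ := by ring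
    have := abs_le_of_sq_le_mul (by positivity) (by positivity) h4
    linarith
  have hux : |(l θ₁ - l θ₂) * ∑ t ∈ Finset.range n, u (t + 1) * x t| ≤ Δ * Y := by
    rw [abs_mul]
    exact mul_le_mul_of_nonneg_right (abs_le_of_sq_le_sq hldiff hΔ0) hY0
  -- The squares factor as difference times sum. In the cross term, the multiple of ∑ u·x is
  -- explicit in θ and only q needs the Abel bound.
  have hmain : excess u (w θ₁) n - excess u (w θ₂) n =
      (∑ t ∈ Finset.range n, (w θ₁ t - w θ₂ t) * (w θ₁ t + w θ₂ t))
      + 2 * ((l θ₁ - l θ₂) * ∑ t ∈ Finset.range n, u (t + 1) * x t)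
      + 2 * ∑ t ∈ Finset.range n, u (t + 1) * q t := by
    simp only [excess, Finset.mul_sum, ← Finset.sum_add_distrib, ← Finset.sum_sub_distrib]
    refine Finset.sum_congr rfl fun t _ => ?_
    have := hdiff t
    have e : q t = w θ₁ t - w θ₂ t - (l θ₁ - l θ₂) * x t := by rw [this]; ring
    rw [e]; ring
  change |excess u (w θ₁) n - excess u (w θ₂) n| ≤ _
  rw [hmain]
  have henv : envelope u x w₀ n = W + R + Y := rfl
  rw [henv]
  have tri := abs_add_three (∑ t ∈ Finset.range n, (w θ₁ t - w θ₂ t) * (w θ₁ t + w θ₂ t))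
    (2 * ((l θ₁ - l θ₂) * ∑ t ∈ Finset.range n, u (t + 1) * x t))
    (2 * ∑ t ∈ Finset.range n, u (t + 1) * q t)
  rw [abs_mul 2, abs_mul 2, abs_two] at tri
  have hfin : ((2 + 2 * H * F) * W + 2 * (2 * (2 * hi ^ 2 + 2 * G)) * W) + 2 * Y
      + 2 * (R + A * F * W) ≤ ((2 + 2 * H * F) + 2 * (2 * (2 * hi ^ 2 + 2 * G)) + 2
        + 2 * (1 + A * F)) * (W + R + Y) := by
    have hG0 : 0 ≤ G := by positivity
    have hF0 : 0 ≤ F := by positivity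
    have a1 : 0 ≤ (2 + 2 * H * F) * (R + Y) := by positivity
    have a2 : 0 ≤ 2 * (2 * (2 * hi ^ 2 + 2 * G)) * (R + Y) := by positivity
    have a3 : 0 ≤ A * F * (R + Y) := by positivity
    linarith
  calc _ ≤ Δ * (((2 + 2 * H * F) * W + 2 * (2 * (2 * hi ^ 2 + 2 * G)) * W) + 2 * Y
      + 2 * (R + A * F * W)) := by linarith
    _ ≤ _ := mul_le_mul_of_nonneg_left hfin hΔ0

/-! ### Second moments of martingale transforms -/

section Moments

variable {Ω : Type*} {m mΩ : MeasurableSpace Ω} {μ : Measure Ω}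

/-- On the sub-σ-algebra the measure with density X coincides with c·μ. Working with `ℝ≥0∞`-valued
integrals avoids assuming that the product is integrable. -/
lemma lintegral_mul_ofReal_of_condExp_eq_const [IsFiniteMeasure μ] (hm : m ≤ mΩ) {X : Ω → ℝ}
    (hX : 0 ≤ X) (hXi : Integrable X μ) {c : ℝ} (h : μ[X | m] =ᵐ[μ] fun _ => c)
    {Y : Ω → ℝ≥0∞} (hY : Measurable[m] Y) :
    ∫⁻ ω, Y ω * ENNReal.ofReal (X ω) ∂μ = ENNReal.ofReal c * ∫⁻ ω, Y ω ∂μ := by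
  have hmeas : (μ.withDensity fun ω => ENNReal.ofReal (X ω)).trim hm =
      (ENNReal.ofReal c • μ).trim hm := by
    refine @Measure.ext _ m _ _ fun s hs => ?_
    rw [trim_measurableSet_eq hm hs, trim_measurableSet_eq hm hs, withDensity_apply _ (hm s hs),
      ← ofReal_integral_eq_lintegral_ofReal hXi.integrableOn (ae_of_all _ hX),
      ← setIntegral_condExp hm hXi hs, setIntegral_congr_ae (g := fun _ => c) (hm s hs)
        (h.mono fun ω hω _ => hω)]
    simp only [setIntegral_const, smul_eq_mul, Measure.smul_apply]
    rw [ENNReal.ofReal_mul measureReal_nonneg, ofReal_measureReal, mul_comm]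
  have hXm : AEMeasurable (fun ω => ENNReal.ofReal (X ω)) μ := hXi.aemeasurable.ennreal_ofReal
  calc ∫⁻ ω, Y ω * ENNReal.ofReal (X ω) ∂μ
      = ∫⁻ ω, Y ω ∂(μ.withDensity fun ω => ENNReal.ofReal (X ω)) := by
        rw [lintegral_withDensity_eq_lintegral_mul₀ hXm (hY.mono hm le_rfl).aemeasurable]
        simp_rw [Pi.mul_apply, mul_comm]
    _ = ∫⁻ ω, Y ω ∂((μ.withDensity fun ω => ENNReal.ofReal (X ω)).trim hm) :=
        (lintegral_trim hm hY).symm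
    _ = ∫⁻ ω, Y ω ∂(ENNReal.ofReal c • μ) := by rw [hmeas, lintegral_trim hm hY]
    _ = _ := by rw [lintegral_smul_measure, smul_eq_mul]

/-- Square integrability of the product is a conclusion: constant conditional variance transfers it
from g, with no fourth moments involved. -/
lemma memLp_two_mul_of_condExp_sq_eq_const [IsFiniteMeasure μ] (hm : m ≤ mΩ) {g X : Ω → ℝ}
    (hg : Measurable[m] g) (hg2 : MemLp g 2 μ) (hX : Measurable X)
    (hXi : Integrable (fun ω => X ω ^ 2) μ) {σ : ℝ}
    (h : μ[fun ω => X ω ^ 2 | m] =ᵐ[μ] fun _ => σ ^ 2) :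
    MemLp (fun ω => g ω * X ω) 2 μ ∧
      ∫ ω, (g ω * X ω) ^ 2 ∂μ = σ ^ 2 * ∫ ω, g ω ^ 2 ∂μ := by
  have hgm : Measurable g := hg.mono hm le_rfl
  have hgi : Integrable (fun ω => g ω ^ 2) μ := (memLp_two_iff_integrable_sq hgm.aestronglyMeasurable).1 hg2
  have key := lintegral_mul_ofReal_of_condExp_eq_const hm (fun ω => sq_nonneg (X ω)) hXi h
    (Y := fun ω => ENNReal.ofReal (g ω ^ 2)) (ENNReal.measurable_ofReal.comp (hg.pow_const 2))
  simp_rw [← ENNReal.ofReal_mul (sq_nonneg (g _)), ← mul_pow] at key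
  have hfin : ∫⁻ ω, ENNReal.ofReal (g ω ^ 2) ∂μ < ∞ := hgi.lintegral_lt_top
  have hsm : AEStronglyMeasurable (fun ω => (g ω * X ω) ^ 2) μ :=
    ((hgm.mul hX).pow_const 2).aestronglyMeasurable
  have hint : Integrable (fun ω => (g ω * X ω) ^ 2) μ := by
    refine (lintegral_ofReal_ne_top_iff_integrable hsm (ae_of_all _ fun ω => sq_nonneg _)).1 ?_
    rw [key]
    exact ENNReal.mul_ne_top ENNReal.ofReal_ne_top hfin.ne
  refine ⟨(memLp_two_iff_integrable_sq (hgm.mul hX).aestronglyMeasurable).2 hint, ?_⟩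
  rw [integral_eq_lintegral_of_nonneg_ae (ae_of_all _ fun ω => sq_nonneg _) hsm, key,
    integral_eq_lintegral_of_nonneg_ae (ae_of_all _ fun ω => sq_nonneg _) hgi.aestronglyMeasurable,
    ENNReal.toReal_mul, ENNReal.toReal_ofReal (sq_nonneg σ)]

lemma integral_mul_eq_zero_of_condExp_eq_zero [IsFiniteMeasure μ] (hm : m ≤ mΩ) {g X : Ω → ℝ}
    (hg : Measurable[m] g) (hX : Integrable X μ) (hgX : Integrable (fun ω => g ω * X ω) μ)
    (h : μ[X | m] =ᵐ[μ] 0) : ∫ ω, g ω * X ω ∂μ = 0 := by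
  rw [← integral_condExp hm]
  have e := condExp_mul_of_stronglyMeasurable_left (μ := μ) hg.stronglyMeasurable hgX hX
  refine integral_eq_zero_of_ae (e.trans ?_)
  filter_upwards [h] with ω hω
  simp [hω]

lemma integral_sq_sum_eq_of_condExp_eq_zero [IsFiniteMeasure μ] {G : ℕ → MeasurableSpace Ω}
    (hG : Monotone G) (hle : ∀ t, G t ≤ mΩ) {d : ℕ → Ω → ℝ}
    (hd : ∀ t, Measurable[G (t + 1)] (d t)) (hd2 : ∀ t, MemLp (d t) 2 μ)
    (hc : ∀ t, μ[d t | G t] =ᵐ[μ] 0) (n : ℕ) :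
    ∫ ω, (∑ t ∈ Finset.range n, d t ω) ^ 2 ∂μ =
      ∑ t ∈ Finset.range n, ∫ ω, d t ω ^ 2 ∂μ := by
  induction n with
  | zero => simp
  | succ n ih =>
    have hS : MemLp (fun ω => ∑ t ∈ Finset.range n, d t ω) 2 μ :=
      memLp_finsetSum _ fun t _ => hd2 t
    have hSm : Measurable[G n] (fun ω => ∑ t ∈ Finset.range n, d t ω) :=
      Finset.measurable_sum _ fun t ht =>
        (hd t).mono (hG (Finset.mem_range.1 ht)) le_rfl
    have hprod : Integrable (fun ω => (∑ t ∈ Finset.range n, d t ω) * d n ω) μ :=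
      hS.integrable_mul (hd2 n)
    have h0 := integral_mul_eq_zero_of_condExp_eq_zero (hle n) hSm
      ((hd2 n).integrable one_le_two) hprod (hc n)
    simp_rw [Finset.sum_range_succ, add_sq, mul_assoc]
    rw [integral_add, integral_add, ih, integral_const_mul, h0]
    · ring
    · exact hS.integrable_sq
    · exact hprod.const_mul 2
    · exact hS.integrable_sq.add (hprod.const_mul 2)
    · exact (hd2 n).integrable_sq

end Moments

/-! ### Error processes: martingale transforms and centred squares -/

section ErrorProcess

variable {Ω : Type*} [mΩ : MeasurableSpace Ω] {μ : Measure Ω}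
  {X : ℕ → Ω → ℝ} {G : ℕ → MeasurableSpace Ω} {σ : ℝ}

namespace ErrorCondition

lemma measurable (h : ErrorCondition μ X G σ) (t : ℕ) : Measurable (X (t + 1)) :=
  (h.mds.adapted (t + 1) (by omega)).mono (h.mds.le _) le_rfl

lemma identDistrib (h : ErrorCondition μ X G σ) (t : ℕ) :
    IdentDistrib (X (t + 1)) (X 1) μ μ := by
  have := (h.stationary t).comp (u := fun f : ℕ → ℝ => f 0) (measurable_pi_apply 0)
  simpa [Function.comp_def, add_comm] using this

lemma memLp_two (h : ErrorCondition μ X G σ) (t : ℕ) : MemLp (X (t + 1)) 2 μ :=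
  (memLp_two_iff_integrable_sq (h.measurable t).aestronglyMeasurable).2
    (h.sq_integrable _ (by omega))

variable [IsProbabilityMeasure μ]

lemma transform (h : ErrorCondition μ X G σ) {g : ℕ → Ω → ℝ} (hg : ∀ t, Measurable[G t] (g t))
    (hg2 : ∀ t, MemLp (g t) 2 μ) (t : ℕ) :
    MemLp (fun ω => g t ω * X (t + 1) ω) 2 μ ∧
      ∫ ω, (g t ω * X (t + 1) ω) ^ 2 ∂μ = σ ^ 2 * ∫ ω, g t ω ^ 2 ∂μ :=
  memLp_two_mul_of_condExp_sq_eq_const (h.mds.le t) (hg t) (hg2 t) (h.measurable t)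
    (h.sq_integrable _ (by omega)) (by simpa using h.condVar (t + 1) (by omega))

lemma integral_mul_eq_zero (h : ErrorCondition μ X G σ) {t : ℕ} {g : Ω → ℝ}
    (hg : Measurable[G t] g) (hg2 : MemLp g 2 μ) : ∫ ω, g ω * X (t + 1) ω ∂μ = 0 :=
  integral_mul_eq_zero_of_condExp_eq_zero (h.mds.le t) hg (h.mds.integrable _ (by omega))
    (hg2.integrable_mul (h.memLp_two t)) (by simpa using h.mds.condExp_eq_zero (t + 1) (by omega))

lemma integral_sq (h : ErrorCondition μ X G σ) (t : ℕ) : ∫ ω, X (t + 1) ω ^ 2 ∂μ = σ ^ 2 := by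
  rw [← integral_condExp (h.mds.le t)]
  have := h.condVar (t + 1) (by omega)
  rw [Nat.add_sub_cancel] at this
  rw [integral_congr_ae this]
  simp

lemma integral_sq_sum (h : ErrorCondition μ X G σ) {g : ℕ → Ω → ℝ}
    (hg : ∀ t, Measurable[G t] (g t)) (hg2 : ∀ t, MemLp (g t) 2 μ) (n : ℕ) :
    ∫ ω, (∑ t ∈ Finset.range n, g t ω * X (t + 1) ω) ^ 2 ∂μ =
      σ ^ 2 * ∑ t ∈ Finset.range n, ∫ ω, g t ω ^ 2 ∂μ := by
  rw [integral_sq_sum_eq_of_condExp_eq_zero h.mds.mono h.mds.le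
    (d := fun t ω => g t ω * X (t + 1) ω)]
  · rw [Finset.mul_sum]
    exact Finset.sum_congr rfl fun t _ => (h.transform hg hg2 t).2
  · exact fun t => ((hg t).mono (h.mds.mono t.le_succ) le_rfl).mul
      (h.mds.adapted (t + 1) (by omega))
  · exact fun t => (h.transform hg hg2 t).1
  · intro t
    have h0 := h.mds.condExp_eq_zero (t + 1) (by omega)
    rw [Nat.add_sub_cancel] at h0
    refine (condExp_mul_of_stronglyMeasurable_left (hg t).stronglyMeasurable
      ((hg2 t).integrable_mul (h.memLp_two t)) (h.mds.integrable _ (by omega))).trans ?_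
    filter_upwards [h0] with ω hω
    simp [hω]

lemma memLp_sum (h : ErrorCondition μ X G σ) {g : ℕ → Ω → ℝ}
    (hg : ∀ t, Measurable[G t] (g t)) (hg2 : ∀ t, MemLp (g t) 2 μ) (n : ℕ) :
    MemLp (fun ω => ∑ t ∈ Finset.range n, g t ω * X (t + 1) ω) 2 μ :=
  memLp_finsetSum _ fun t _ => (h.transform hg hg2 t).1

/-- If the initial σ-algebra is trivial, the fourth moments are finite. -/
lemma integrable_pow_four (h : ErrorCondition μ X G σ) (hG : G 0 = ⊥) (t : ℕ) :
    Integrable (fun ω => X (t + 1) ω ^ 4) μ ∧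
      ∫ ω, X (t + 1) ω ^ 4 ∂μ = ∫ ω, X 1 ω ^ 4 ∂μ := by
  have hid := (h.identDistrib t).comp (u := fun r : ℝ => r ^ 4) (by fun_prop)
  -- Conditioning on the trivial σ-algebra is plain integration, so the first error has a finite
  -- fourth moment; stationarity passes it on to all the others.
  have h4 := h.fourth 1 le_rfl
  rw [Nat.sub_self, hG, condLExp_bot] at h4
  obtain ⟨ω, hω⟩ := h4.exists
  have h1 : Integrable (fun ω => X 1 ω ^ 4) μ :=
    (lintegral_ofReal_ne_top_iff_integrable ((h.measurable 0).pow_const 4).aestronglyMeasurable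
      (ae_of_all _ fun ω => by positivity)).1 hω.ne
  exact ⟨hid.integrable_iff.2 h1, hid.integral_eq⟩

/-- The centred squares of the errors, weighted by `1 / t`, have bounded variance. -/
lemma exists_integral_sq_sum_sq_sub_le (h : ErrorCondition μ X G σ) (hG : G 0 = ⊥) :
    (∀ n, MemLp (fun ω => ∑ t ∈ Finset.range n,
      (X (t + 1) ω ^ 2 - σ ^ 2) / ((t : ℝ) + 1)) 2 μ) ∧
    ∃ C : ℝ, 0 ≤ C ∧ ∀ n, ∫ ω, (∑ t ∈ Finset.range n,
      (X (t + 1) ω ^ 2 - σ ^ 2) / ((t : ℝ) + 1)) ^ 2 ∂μ ≤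
        C * ∑ t ∈ Finset.range n, 1 / ((t : ℝ) + 1) := by
  have hX2 : ∀ t, MemLp (fun ω => X (t + 1) ω ^ 2) 2 μ := fun t => by
    refine (memLp_two_iff_integrable_sq ((h.measurable t).pow_const 2).aestronglyMeasurable).2 ?_
    simp_rw [← pow_mul]
    exact (h.integrable_pow_four hG t).1
  have hd : ∀ t, MemLp (fun ω => X (t + 1) ω ^ 2 - σ ^ 2) 2 μ := fun t =>
    (hX2 t).sub (memLp_const _)
  have hdt : ∀ t : ℕ, MemLp (fun ω => (X (t + 1) ω ^ 2 - σ ^ 2) / ((t : ℝ) + 1)) 2 μ := by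
    intro t
    simp_rw [div_eq_mul_inv]
    exact (hd t).mul_const _
  refine ⟨fun n => memLp_finsetSum _ fun t _ => hdt t,
    ∫ ω, (X 1 ω ^ 2 - σ ^ 2) ^ 2 ∂μ, integral_nonneg fun ω => sq_nonneg _, fun n => ?_⟩
  rw [integral_sq_sum_eq_of_condExp_eq_zero h.mds.mono h.mds.le
    (d := fun t ω => (X (t + 1) ω ^ 2 - σ ^ 2) / ((t : ℝ) + 1)) _ hdt, Finset.mul_sum]
  · refine Finset.sum_le_sum fun t _ => ?_
    have hid := (h.identDistrib t).comp (u := fun r : ℝ => (r ^ 2 - σ ^ 2) ^ 2) (by fun_prop)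
    have := hid.integral_eq
    simp only [Function.comp_apply] at this
    simp_rw [div_pow]
    rw [integral_div, this, mul_one_div]
    -- Weakening 1/(t+1)² to 1/(t+1) is harmless: a variance of order ln n is enough for
    -- `SmallL1.of_integral_sq_le`.
    apply div_le_div_of_nonneg_left (integral_nonneg fun ω => sq_nonneg _) (by positivity)
    nlinarith [(t.cast_nonneg : (0 : ℝ) ≤ t)]
  · intro t
    have h0 := h.condVar (t + 1) (by omega)
    rw [Nat.add_sub_cancel] at h0
    have e : (fun ω => (X (t + 1) ω ^ 2 - σ ^ 2) / ((t : ℝ) + 1)) =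
        ((t : ℝ) + 1)⁻¹ • ((fun ω => X (t + 1) ω ^ 2) - fun _ => σ ^ 2) := by
      ext ω; simp [div_eq_inv_mul]
    rw [e]
    refine (condExp_smul _ _ _).trans ?_
    have h1 := condExp_sub (μ := μ) (h.sq_integrable (t + 1) (by omega))
      (integrable_const (σ ^ 2)) (G t)
    filter_upwards [h0, h1] with ω hω hω1
    rw [Pi.smul_apply, hω1, Pi.sub_apply, hω, condExp_const (h.mds.le t)]
    simp
  · exact fun t => (((h.mds.adapted (t + 1) (by omega)).pow_const 2).sub_const _).div_const _

end ErrorCondition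

end ErrorProcess

/-! ### Logarithmic normalization -/

lemma sum_one_div_eq_harmonic (n : ℕ) :
    ∑ t ∈ Finset.range n, 1 / ((t : ℝ) + 1) = (harmonic n : ℝ) := by
  simp [harmonic]

lemma sum_one_div_le (n : ℕ) : ∑ t ∈ Finset.range n, 1 / ((t : ℝ) + 1) ≤ 1 + Real.log n := by
  rw [sum_one_div_eq_harmonic]
  exact harmonic_le_one_add_log n

lemma tendsto_log_natCast : Tendsto (fun n : ℕ => Real.log n) atTop atTop :=
  Real.tendsto_log_atTop.comp tendsto_natCast_atTop_atTop

lemma tendsto_inv_log_natCast : Tendsto (fun n : ℕ => (Real.log n)⁻¹) atTop (𝓝 0) :=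
  tendsto_inv_atTop_zero.comp tendsto_log_natCast

lemma eventually_log_pos : ∀ᶠ n : ℕ in atTop, 0 < Real.log n :=
  tendsto_log_natCast.eventually_gt_atTop 0

lemma tendsto_inv_log_mul_sum_one_div :
    Tendsto (fun n : ℕ => (Real.log n)⁻¹ * ∑ t ∈ Finset.range n, 1 / ((t : ℝ) + 1)) atTop
      (𝓝 1) := by
  have hup : Tendsto (fun n : ℕ => (Real.log n)⁻¹ + 1) atTop (𝓝 1) := by
    simpa using tendsto_inv_log_natCast.add_const 1
  refine tendsto_of_tendsto_of_tendsto_of_le_of_le' tendsto_const_nhds hup ?_ ?_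
  · filter_upwards [eventually_log_pos, eventually_gt_atTop 0] with n hn hn0
    have : Real.log n ≤ ∑ t ∈ Finset.range n, 1 / ((t : ℝ) + 1) := by
      rw [sum_one_div_eq_harmonic]
      refine le_trans (Real.log_le_log (by exact_mod_cast hn0) ?_) (log_add_one_le_harmonic n)
      push_cast; linarith
    rw [inv_mul_eq_div, le_div_iff₀ hn]
    linarith
  · filter_upwards [eventually_log_pos] with n hn
    have := sum_one_div_le n
    rw [inv_mul_eq_div, div_le_iff₀ hn]
    field_simp
    linarith

/-! ### Sequences negligible in L¹ relative to ln n -/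

section SmallL1

variable {Ω : Type*} [mΩ : MeasurableSpace Ω] {μ : Measure Ω}

/-- `E|X_n| = o(ln n)`. -/
structure SmallL1 (μ : Measure Ω) (X : ℕ → Ω → ℝ) : Prop where
  integrable : ∀ n, Integrable (X n) μ
  tendsto : Tendsto (fun n : ℕ => (Real.log n)⁻¹ * ∫ ω, |X n ω| ∂μ) atTop (𝓝 0)

namespace SmallL1

lemma of_le {X : ℕ → Ω → ℝ} (hX : ∀ n, Integrable (X n) μ) {v : ℕ → ℝ}
    (hv : Tendsto (fun n : ℕ => (Real.log n)⁻¹ * v n) atTop (𝓝 0))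
    (h : ∀ᶠ n in atTop, ∫ ω, |X n ω| ∂μ ≤ v n) : SmallL1 μ X := by
  refine ⟨hX, tendsto_of_tendsto_of_tendsto_of_le_of_le' tendsto_const_nhds hv ?_ ?_⟩
  · filter_upwards [eventually_log_pos] with n hn
    exact mul_nonneg (inv_nonneg.2 hn.le) (integral_nonneg fun ω => abs_nonneg _)
  · filter_upwards [eventually_log_pos, h] with n hn hn'
    exact mul_le_mul_of_nonneg_left hn' (inv_nonneg.2 hn.le)

lemma of_bounded {X : ℕ → Ω → ℝ} (hX : ∀ n, Integrable (X n) μ) {C : ℝ}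
    (h : ∀ n, ∫ ω, |X n ω| ∂μ ≤ C) : SmallL1 μ X :=
  of_le hX (v := fun _ => C) (by simpa using tendsto_inv_log_natCast.mul_const C)
    (Eventually.of_forall h)

lemma add {X Y : ℕ → Ω → ℝ} (hX : SmallL1 μ X) (hY : SmallL1 μ Y) :
    SmallL1 μ (fun n ω => X n ω + Y n ω) := by
  refine of_le (fun n => (hX.integrable n).add (hY.integrable n))
    (v := fun n => ∫ ω, |X n ω| ∂μ + ∫ ω, |Y n ω| ∂μ) ?_ (Eventually.of_forall fun n => ?_)
  · simpa [mul_add] using hX.tendsto.add hY.tendsto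
  · rw [← integral_add (hX.integrable n).abs (hY.integrable n).abs]
    exact integral_mono ((hX.integrable n).add (hY.integrable n)).abs
      ((hX.integrable n).abs.add (hY.integrable n).abs) fun ω => abs_add_le _ _

lemma const_mul {X : ℕ → Ω → ℝ} (hX : SmallL1 μ X) (c : ℝ) :
    SmallL1 μ (fun n ω => c * X n ω) := by
  refine of_le (fun n => (hX.integrable n).const_mul c)
    (v := fun n => |c| * ∫ ω, |X n ω| ∂μ) ?_ (Eventually.of_forall fun n => ?_)
  · simpa [mul_left_comm] using hX.tendsto.const_mul |c|
  · simp_rw [abs_mul]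
    rw [integral_const_mul]

lemma congr {X Y : ℕ → Ω → ℝ} (hX : SmallL1 μ X) (h : ∀ n ω, X n ω = Y n ω) : SmallL1 μ Y := by
  have : X = Y := funext fun n => funext fun ω => h n ω
  exact this ▸ hX

lemma abs {X : ℕ → Ω → ℝ} (hX : SmallL1 μ X) : SmallL1 μ (fun n ω => |X n ω|) :=
  ⟨fun n => (hX.integrable n).abs, by simpa using hX.tendsto⟩

/-- Second moments of order `ln n` suffice. -/
lemma of_integral_sq_le [IsProbabilityMeasure μ] {X : ℕ → Ω → ℝ} (hX : ∀ n, MemLp (X n) 2 μ)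
    {C : ℝ} (h : ∀ n : ℕ, ∫ ω, X n ω ^ 2 ∂μ ≤ C * (1 + Real.log n)) : SmallL1 μ X := by
  have hv : Tendsto (fun n : ℕ => (Real.log n)⁻¹ * Real.sqrt (C * (1 + Real.log n))) atTop
      (𝓝 0) := by
    have h1 : Tendsto (fun n : ℕ => Real.sqrt (C * ((Real.log n)⁻¹ * (Real.log n)⁻¹ +
        (Real.log n)⁻¹))) atTop (𝓝 0) := by
      have := ((tendsto_inv_log_natCast.mul tendsto_inv_log_natCast).add
        tendsto_inv_log_natCast).const_mul C
      have := (Real.continuous_sqrt.tendsto _).comp this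
      simpa [Function.comp_def] using this
    refine h1.congr' ?_
    filter_upwards [eventually_log_pos] with n hn
    have e : C * ((Real.log n)⁻¹ * (Real.log n)⁻¹ + (Real.log n)⁻¹) =
        (Real.log n)⁻¹ ^ 2 * (C * (1 + Real.log n)) := by field_simp
    rw [e, Real.sqrt_mul (sq_nonneg _), Real.sqrt_sq (inv_nonneg.2 hn.le)]
  refine of_le (fun n => (hX n).integrable one_le_two) hv (Eventually.of_forall fun n => ?_)
  refine Real.le_sqrt_of_sq_le (le_trans ?_ (h n))
  -- Nonnegativity of the variance of |X_n| is the inequality (E|X_n|)² ≤ E X_n².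
  have hv := variance_nonneg (fun ω => |X n ω|) μ
  rw [variance_eq_sub (X := fun ω => |X n ω|) (hX n).abs] at hv
  simp only [Pi.pow_apply, sq_abs] at hv
  linarith

end SmallL1

end SmallL1

/-- The solution of `p_{t+1} = (1 - θ / (t+1)) p_t + f_t / (t+1)` started at `p₀`. -/
noncomputable def recur (θ p₀ : ℝ) (f : ℕ → ℝ) : ℕ → ℝ
  | 0 => p₀
  | t + 1 => (1 - θ / ((t : ℝ) + 1)) * recur θ p₀ f t + f t / ((t : ℝ) + 1)

lemma eq_recur {θ : ℝ} {p f : ℕ → ℝ}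
    (hp : ∀ t : ℕ, p (t + 1) = (1 - θ / ((t : ℝ) + 1)) * p t + f t / ((t : ℝ) + 1)) (t : ℕ) :
    p t = recur θ (p 0) f t := by
  induction t with
  | zero => rfl
  | succ t ih => rw [hp, recur, ← ih]

/-- Superposition separates the path started at zero, whose moments are controlled, from the
response to the initial value. -/
lemma recur_add (θ p₀ q₀ : ℝ) (f g : ℕ → ℝ) (t : ℕ) :
    recur θ (p₀ + q₀) (fun s => f s + g s) t = recur θ p₀ f t + recur θ q₀ g t := by
  induction t with
  | zero => rfl
  | succ t ih => simp only [recur, ih]; ring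

lemma recur_mul (θ p₀ : ℝ) (a : ℝ) (t : ℕ) :
    recur θ (a * p₀) (fun _ => 0) t = a * recur θ p₀ (fun _ => 0) t := by
  induction t with
  | zero => rfl
  | succ t ih => simp only [recur, ih]; ring

lemma sum_one_div_sq_le (n : ℕ) : ∑ t ∈ Finset.range n, 1 / ((t : ℝ) + 1) ^ 2 ≤ 2 := by
  -- The sharper bound is what makes the induction close, by comparison with a telescoping series.
  have h : ∑ t ∈ Finset.range n, 1 / ((t : ℝ) + 1) ^ 2 ≤ 2 - 2 / ((n : ℝ) + 1) := by
    induction n with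
    | zero => norm_num
    | succ n ih =>
      rw [Finset.sum_range_succ]
      have : 1 / ((n : ℝ) + 1) ^ 2 ≤ 2 / ((n : ℝ) + 1) - 2 / ((n + 1 : ℕ) + 1 : ℝ) := by
        push_cast
        rw [div_sub_div _ _ (by positivity) (by positivity), div_le_div_iff₀ (by positivity)
          (by positivity)]
        nlinarith [(n.cast_nonneg : (0 : ℝ) ≤ n), sq_nonneg (n : ℝ)]
      linarith
  have : 0 ≤ 2 / ((n : ℝ) + 1) := by positivity
  linarith

/-! ### Negligible boundary, weighted and martingale terms -/

section Small

variable {Ω : Type*} [mΩ : MeasurableSpace Ω] {μ : Measure Ω}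

/-- Handles the boundary term of the telescoped identities: it stays bounded in L¹. -/
lemma SmallL1.natCast_mul {Z : ℕ → Ω → ℝ} (hZ : ∀ t, Integrable (Z t) μ) {C : ℝ}
    (h : ∀ t : ℕ, ∫ ω, |Z t ω| ∂μ ≤ C / ((t : ℝ) + 1)) :
    SmallL1 μ (fun n ω => (n : ℝ) * Z n ω) := by
  refine .of_bounded (fun n => (hZ n).const_mul _) (C := C) fun n => ?_
  simp_rw [abs_mul, Nat.abs_cast]
  rw [integral_const_mul]
  have h1 := h n
  rw [le_div_iff₀ (by positivity)] at h1
  have : 0 ≤ ∫ ω, |Z n ω| ∂μ := integral_nonneg fun ω => abs_nonneg _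
  linarith

/-- Handles the second-order terms: the additional 1/(t+1) makes their L¹ norms summable. -/
lemma SmallL1.sum_div {Z : ℕ → Ω → ℝ} (hZ : ∀ t, Integrable (Z t) μ) {C : ℝ} (hC : 0 ≤ C)
    (h : ∀ t : ℕ, ∫ ω, |Z t ω| ∂μ ≤ C / ((t : ℝ) + 1)) :
    SmallL1 μ (fun n ω => ∑ t ∈ Finset.range n, Z t ω / ((t : ℝ) + 1)) := by
  have hi : ∀ t : ℕ, Integrable (fun ω => Z t ω / ((t : ℝ) + 1)) μ := fun t => (hZ t).div_const _
  refine .of_bounded (fun n => integrable_finsetSum _ fun t _ => hi t) (C := C * 2) fun n => ?_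
  calc ∫ ω, |∑ t ∈ Finset.range n, Z t ω / ((t : ℝ) + 1)| ∂μ
      ≤ ∫ ω, ∑ t ∈ Finset.range n, |Z t ω / ((t : ℝ) + 1)| ∂μ :=
        integral_mono (integrable_finsetSum _ fun t _ => hi t).abs
          (integrable_finsetSum _ fun t _ => (hi t).abs) fun ω => Finset.abs_sum_le_sum_abs _ _
    _ = ∑ t ∈ Finset.range n, ∫ ω, |Z t ω / ((t : ℝ) + 1)| ∂μ :=
        integral_finsetSum _ fun t _ => (hi t).abs
    _ ≤ ∑ t ∈ Finset.range n, C * (1 / ((t : ℝ) + 1) ^ 2) := by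
        refine Finset.sum_le_sum fun t _ => ?_
        have hpos : (0 : ℝ) < (t : ℝ) + 1 := by positivity
        simp_rw [abs_div, abs_of_pos hpos]
        rw [integral_div, div_le_iff₀ hpos]
        refine (h t).trans (le_of_eq ?_)
        field_simp
    _ ≤ C * 2 := by
        rw [← Finset.mul_sum]
        exact mul_le_mul_of_nonneg_left (sum_one_div_sq_le n) hC

/-- The variance of the transform is O(ln n), hence its L¹ norm is O(√(ln n)). -/
lemma SmallL1.transform [IsProbabilityMeasure μ] {X : ℕ → Ω → ℝ} {G : ℕ → MeasurableSpace Ω}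
    {σ : ℝ} (h : ErrorCondition μ X G σ) {g : ℕ → Ω → ℝ} (hg : ∀ t, Measurable[G t] (g t))
    (hg2 : ∀ t, MemLp (g t) 2 μ) {C : ℝ} (hC : 0 ≤ C)
    (hgC : ∀ t : ℕ, ∫ ω, g t ω ^ 2 ∂μ ≤ C / ((t : ℝ) + 1)) :
    SmallL1 μ (fun n ω => ∑ t ∈ Finset.range n, g t ω * X (t + 1) ω) := by
  refine .of_integral_sq_le (h.memLp_sum hg hg2) (C := σ ^ 2 * C) fun n => ?_
  rw [h.integral_sq_sum hg hg2, mul_assoc]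
  refine mul_le_mul_of_nonneg_left ?_ (sq_nonneg σ)
  calc ∑ t ∈ Finset.range n, ∫ ω, g t ω ^ 2 ∂μ
      ≤ ∑ t ∈ Finset.range n, C * (1 / ((t : ℝ) + 1)) :=
        Finset.sum_le_sum fun t _ => (hgC t).trans (le_of_eq (by ring))
    _ ≤ C * (1 + Real.log n) := by
        rw [← Finset.mul_sum]
        exact mul_le_mul_of_nonneg_left (sum_one_div_le n) hC

end Small

/-! ### The state and the gain-induced drift, started at zero -/

section ZeroStart

variable {Ω : Type*}

/-- The centred learning path started at zero. -/
noncomputable def state (c a : ℝ) (ε : ℕ → Ω → ℝ) (t : ℕ) (ω : Ω) : ℝ :=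
  recur c 0 (fun s => a * ε (s + 1) ω) t

/-- The drift component of the tracking error, started at zero and driven by `state`. -/
noncomputable def drift (θ k c a : ℝ) (ε : ℕ → Ω → ℝ) (t : ℕ) (ω : Ω) : ℝ :=
  recur θ 0 (fun s => k * state c a ε s ω) t

lemma state_succ (c a : ℝ) (ε : ℕ → Ω → ℝ) (t : ℕ) (ω : Ω) :
    state c a ε (t + 1) ω =
      (1 - c / ((t : ℝ) + 1)) * state c a ε t ω + a * ε (t + 1) ω / ((t : ℝ) + 1) := rfl

lemma drift_succ (θ k c a : ℝ) (ε : ℕ → Ω → ℝ) (t : ℕ) (ω : Ω) :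
    drift θ k c a ε (t + 1) ω =
      (1 - θ / ((t : ℝ) + 1)) * drift θ k c a ε t ω
        + k * state c a ε t ω / ((t : ℝ) + 1) := rfl

variable [mΩ : MeasurableSpace Ω] {μ : Measure Ω}
  {ε : ℕ → Ω → ℝ} {G : ℕ → MeasurableSpace Ω} {σ : ℝ}

lemma integral_abs_mul_le {f g : Ω → ℝ} (hf : MemLp f 2 μ) (hg : MemLp g 2 μ) :
    ∫ ω, |f ω * g ω| ∂μ ≤ ∫ ω, f ω ^ 2 ∂μ + ∫ ω, g ω ^ 2 ∂μ := by
  rw [← integral_add hf.integrable_sq hg.integrable_sq]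
  refine integral_mono (hf.integrable_mul hg).abs (hf.integrable_sq.add hg.integrable_sq)
    fun ω => ?_
  rw [abs_mul]
  change _ ≤ f ω ^ 2 + g ω ^ 2
  nlinarith [sq_nonneg (|f ω| - |g ω|), sq_abs (f ω), sq_abs (g ω), sq_nonneg (f ω),
    sq_nonneg (g ω)]

namespace ErrorCondition

lemma measurable_state (h : ErrorCondition μ ε G σ) (c a : ℝ) (t : ℕ) :
    Measurable[G t] (state c a ε t) := by
  induction t with
  | zero => exact measurable_const
  | succ t ih =>
    exact ((ih.mono (h.mds.mono t.le_succ) le_rfl).const_mul _).add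
      (((h.mds.adapted (t + 1) (by omega)).const_mul a).div_const _)

lemma measurable_drift (h : ErrorCondition μ ε G σ) (θ k c a : ℝ) (t : ℕ) :
    Measurable[G t] (drift θ k c a ε t) := by
  induction t with
  | zero => exact measurable_const
  | succ t ih =>
    exact ((ih.mono (h.mds.mono t.le_succ) le_rfl).const_mul _).add
      ((((h.measurable_state c a t).mono (h.mds.mono t.le_succ) le_rfl).const_mul k).div_const _)

variable [IsProbabilityMeasure μ]

lemma memLp_state (h : ErrorCondition μ ε G σ) (c a : ℝ) (t : ℕ) :
    MemLp (state c a ε t) 2 μ := by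
  induction t with
  | zero => exact memLp_const 0
  | succ t ih =>
    refine (ih.const_mul (1 - c / ((t : ℝ) + 1))).add ?_
    have := (h.memLp_two t).const_mul (a / ((t : ℝ) + 1))
    convert this using 2
    ring

lemma memLp_drift (h : ErrorCondition μ ε G σ) (θ k c a : ℝ) (t : ℕ) :
    MemLp (drift θ k c a ε t) 2 μ := by
  induction t with
  | zero => exact memLp_const 0
  | succ t ih =>
    refine (ih.const_mul (1 - θ / ((t : ℝ) + 1))).add ?_
    have := (h.memLp_state c a t).const_mul (k / ((t : ℝ) + 1))
    convert this using 2
    ring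

/-- The Lyapunov step in expectation: the state is known before the next error, so the cross term
vanishes. Contraction of t·E x_t² at rate 2c-1 > 0 faces only the noise a²σ²/(t+1). -/
lemma exists_integral_state_sq_le (h : ErrorCondition μ ε G σ) {c : ℝ} (hc : 1 / 2 < c)
    (a : ℝ) : ∃ C : ℝ, 0 ≤ C ∧ ∀ t : ℕ, ∫ ω, state c a ε t ω ^ 2 ∂μ ≤ C / ((t : ℝ) + 1) := by
  have hδ : 0 < (2 * c - 1) / 2 := by linarith
  -- From T on, the correction c²/(t+1) uses up at most half of the rate 2c-1.
  obtain ⟨T, hT⟩ := exists_nat_ge (c ^ 2 / ((2 * c - 1) / 2))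
  refine exists_le_div_add_one (fun t => integral_nonneg fun ω => sq_nonneg _) hδ
    (K := a ^ 2 * σ ^ 2) (by positivity) (T := T) fun t ht => ?_
  set x := state c a ε t with hx
  have hx2 : Integrable (fun ω => x ω ^ 2) μ := (h.memLp_state c a t).integrable_sq
  have hxe : Integrable (fun ω => x ω * ε (t + 1) ω) μ :=
    (h.memLp_state c a t).integrable_mul (h.memLp_two t)
  have he2 := h.sq_integrable (t + 1) (by omega)
  have hstep : ∀ ω, ((t : ℝ) + 1) * state c a ε (t + 1) ω ^ 2 =
      (t + (1 - 2 * c + c ^ 2 / ((t : ℝ) + 1))) * x ω ^ 2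
        + 2 * (1 - c / ((t : ℝ) + 1)) * a * (x ω * ε (t + 1) ω)
        + a ^ 2 / ((t : ℝ) + 1) * ε (t + 1) ω ^ 2 := by
    intro ω
    rw [state_succ, add_one_mul_sq_step _ _ _ t.cast_nonneg]
    ring
  rw [← integral_const_mul]
  simp_rw [hstep]
  have hsum : Integrable (fun ω => (t + (1 - 2 * c + c ^ 2 / ((t : ℝ) + 1))) * x ω ^ 2
        + 2 * (1 - c / ((t : ℝ) + 1)) * a * (x ω * ε (t + 1) ω)) μ :=
    (hx2.const_mul _).add (hxe.const_mul _)
  rw [integral_add hsum (he2.const_mul _),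
    integral_add (hx2.const_mul _) (hxe.const_mul _), integral_const_mul, integral_const_mul,
    integral_const_mul, h.integral_mul_eq_zero (h.measurable_state c a t) (h.memLp_state c a t),
    h.integral_sq]
  have hm : 0 ≤ ∫ ω, x ω ^ 2 ∂μ := integral_nonneg fun ω => sq_nonneg _
  have hcT : c ^ 2 / ((t : ℝ) + 1) ≤ (2 * c - 1) / 2 := by
    rw [div_le_iff₀ hδ] at hT
    rw [div_le_iff₀ (by positivity)]
    have : (T : ℝ) ≤ t := by exact_mod_cast ht
    nlinarith
  have e : a ^ 2 / ((t : ℝ) + 1) * σ ^ 2 = a ^ 2 * σ ^ 2 / ((t : ℝ) + 1) := by ring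
  rw [e]
  nlinarith

/-- The forcing is correlated with the drift, so the cross term does not drop out. The pathwise
Young step is integrated instead, with E x_t² = O(1/t) as input. -/
lemma exists_integral_drift_sq_le (h : ErrorCondition μ ε G σ) {c θ : ℝ} (hc : 1 / 2 < c)
    (hθ : 1 / 2 < θ) (k a : ℝ) :
    ∃ C : ℝ, 0 ≤ C ∧ ∀ t : ℕ, ∫ ω, drift θ k c a ε t ω ^ 2 ∂μ ≤ C / ((t : ℝ) + 1) := by
  obtain ⟨C, hC0, hC⟩ := h.exists_integral_state_sq_le hc a
  obtain ⟨T, hT⟩ := exists_nat_ge (4 * θ ^ 2 / (2 * θ - 1))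
  have hθδ : 0 < 2 * θ - 1 := by linarith
  set A := 4 / (2 * θ - 1) * (1 + θ) ^ 2 + 1 with hA
  refine exists_le_div_add_one (fun t => integral_nonneg fun ω => sq_nonneg _)
    (δ := (2 * θ - 1) / 2) (by linarith)
    (K := A * k ^ 2 * C) (by positivity) (T := T) fun t ht => ?_
  have hTt : (T : ℝ) ≤ t := by exact_mod_cast ht
  set x := state c a ε t with hx
  have hx2 : Integrable (fun ω => x ω ^ 2) μ := (h.memLp_state c a t).integrable_sq
  have hp2 : Integrable (fun ω => drift θ k c a ε t ω ^ 2) μ :=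
    (h.memLp_drift θ k c a t).integrable_sq
  have hp2' : Integrable (fun ω => drift θ k c a ε (t + 1) ω ^ 2) μ :=
    (h.memLp_drift θ k c a (t + 1)).integrable_sq
  have hstep : ∀ ω, ((t : ℝ) + 1) * drift θ k c a ε (t + 1) ω ^ 2 ≤
      (t - (2 * θ - 1) / 2) * drift θ k c a ε t ω ^ 2 + A * k ^ 2 * x ω ^ 2 := by
    intro ω
    have := add_one_mul_sq_step_le hθ (left_mem_Icc.2 le_rfl) (drift θ k c a ε t ω)
      (k * x ω) t.cast_nonneg (by linarith)
    rw [drift_succ]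
    linarith
  have hi := integral_mono (hp2'.const_mul ((t : ℝ) + 1))
    ((hp2.const_mul (t - (2 * θ - 1) / 2)).add (hx2.const_mul (A * k ^ 2))) hstep
  have e := integral_add (hp2.const_mul ((t : ℝ) - (2 * θ - 1) / 2)) (hx2.const_mul (A * k ^ 2))
  simp only [Pi.add_apply] at hi
  rw [e, integral_const_mul, integral_const_mul, integral_const_mul] at hi
  have h3 : A * k ^ 2 * ∫ ω, x ω ^ 2 ∂μ ≤ A * k ^ 2 * (C / ((t : ℝ) + 1)) :=
    mul_le_mul_of_nonneg_left (hC t) (by positivity)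
  have e2 : A * k ^ 2 * (C / ((t : ℝ) + 1)) = A * k ^ 2 * C / ((t : ℝ) + 1) := by ring
  linarith

end ErrorCondition

/-- Summed increments of a product of two recursions. -/
lemma natCast_mul_recur_mul_recur (c θ p₀ q₀ : ℝ) (f g : ℕ → ℝ) (n : ℕ) :
    (n : ℝ) * (recur c p₀ f n * recur θ q₀ g n) =
      ∑ t ∈ Finset.range n,
        ((1 - c - θ) * (recur c p₀ f t * recur θ q₀ g t)
          + c * θ * (recur c p₀ f t * recur θ q₀ g t / ((t : ℝ) + 1))
          + (1 - c / ((t : ℝ) + 1)) * (recur c p₀ f t * g t)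
          + (1 - θ / ((t : ℝ) + 1)) * (recur θ q₀ g t * f t)
          + f t * g t / ((t : ℝ) + 1)) := by
  induction n with
  | zero => simp
  | succ n ih =>
    rw [Finset.sum_range_succ, ← ih]
    have : (n : ℝ) + 1 ≠ 0 := by positivity
    simp only [recur]
    push_cast
    field_simp
    ring

namespace ErrorCondition

variable [IsProbabilityMeasure μ] {c θ : ℝ}

/-- A martingale transform with weights `(1 - b / t)`. -/
lemma smallL1_weighted {X : ℕ → Ω → ℝ} (h : ErrorCondition μ X G σ) {g : ℕ → Ω → ℝ}
    (hg : ∀ t, Measurable[G t] (g t))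
    (hg2 : ∀ t, MemLp (g t) 2 μ) {C : ℝ} (hC : 0 ≤ C)
    (hgC : ∀ t : ℕ, ∫ ω, g t ω ^ 2 ∂μ ≤ C / ((t : ℝ) + 1)) {w : ℕ → ℝ} {A : ℝ}
    (hw : ∀ t, w t ^ 2 ≤ A) :
    SmallL1 μ (fun n ω => ∑ t ∈ Finset.range n, w t * (g t ω * X (t + 1) ω)) := by
  have hA : 0 ≤ A := (sq_nonneg _).trans (hw 0)
  refine (SmallL1.transform h (g := fun t ω => w t * g t ω) (fun t => (hg t).const_mul _)
    (fun t => (hg2 t).const_mul _) (C := A * C) (by positivity) fun t => ?_).congr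
      fun n ω => Finset.sum_congr rfl fun t _ => mul_assoc _ _ _
  simp_rw [mul_pow]
  rw [integral_const_mul, mul_div_assoc]
  exact mul_le_mul (hw t) (hgC t) (integral_nonneg fun ω => sq_nonneg _) hA

/-- Telescoping t·x_t² leaves (2c-1)∑x² against the weighted squares a²∑ε_{t+1}²/(t+1); the
boundary, second-order and martingale terms are negligible. Centring ε² at σ² produces the harmonic
sum. -/
lemma smallL1_state_sq (h : ErrorCondition μ ε G σ) (hG : G 0 = ⊥) (hc : 1 / 2 < c) (a : ℝ) :
    SmallL1 μ (fun n ω => ∑ t ∈ Finset.range n, state c a ε t ω ^ 2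
      - a ^ 2 * σ ^ 2 / (2 * c - 1) * ∑ t ∈ Finset.range n, 1 / ((t : ℝ) + 1)) := by
  obtain ⟨C, hC0, hC⟩ := h.exists_integral_state_sq_le hc a
  have hx2 : ∀ t, Integrable (fun ω => state c a ε t ω ^ 2) μ :=
    fun t => (h.memLp_state c a t).integrable_sq
  have hCabs : ∀ t : ℕ, ∫ ω, |state c a ε t ω ^ 2| ∂μ ≤ C / ((t : ℝ) + 1) := fun t => by
    simp_rw [abs_of_nonneg (sq_nonneg (state c a ε t _))]; exact hC t
  have s1 := SmallL1.natCast_mul hx2 hCabs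
  have s2 := SmallL1.sum_div hx2 hC0 hCabs
  have s3 := h.smallL1_weighted (h.measurable_state c a) (h.memLp_state c a) hC0 hC
    (w := fun t => 1 - c / ((t : ℝ) + 1)) (A := (1 + c) ^ 2)
    fun t => sq_one_sub_div_le (by linarith) le_rfl t.cast_nonneg
  obtain ⟨hm4, C4, -, hC4⟩ := h.exists_integral_sq_sum_sq_sub_le hG
  have s4 : SmallL1 μ (fun n ω => ∑ t ∈ Finset.range n,
      (ε (t + 1) ω ^ 2 - σ ^ 2) / ((t : ℝ) + 1)) :=
    .of_integral_sq_le hm4 (C := |C4|) fun n => (hC4 n).trans <|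
      mul_le_mul (le_abs_self _) (sum_one_div_le n)
        (Finset.sum_nonneg fun t _ => by positivity) (abs_nonneg _)
  have hδ : 2 * c - 1 ≠ 0 := by linarith
  refine (((((s1.const_mul (-1)).add (s2.const_mul (c ^ 2))).add (s3.const_mul (2 * a))).add
    (s4.const_mul (a ^ 2))).const_mul (2 * c - 1)⁻¹).congr fun n ω => ?_
  have key := natCast_mul_recur_mul_recur c c 0 0 (fun s => a * ε (s + 1) ω)
    (fun s => a * ε (s + 1) ω) n
  change (n : ℝ) * (state c a ε n ω * state c a ε n ω) = ∑ t ∈ Finset.range n,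
        ((1 - c - c) * (state c a ε t ω * state c a ε t ω)
          + c * c * (state c a ε t ω * state c a ε t ω / ((t : ℝ) + 1))
          + (1 - c / ((t : ℝ) + 1)) * (state c a ε t ω * (a * ε (t + 1) ω))
          + (1 - c / ((t : ℝ) + 1)) * (state c a ε t ω * (a * ε (t + 1) ω))
          + a * ε (t + 1) ω * (a * ε (t + 1) ω) / ((t : ℝ) + 1)) at key
  have e : ∀ H : ℝ, (2 * c - 1) * (a ^ 2 * σ ^ 2 / (2 * c - 1) * H) = a ^ 2 * σ ^ 2 * H :=
    fun H => by field_simp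
  rw [inv_mul_eq_iff_eq_mul₀ hδ, mul_sub, e, pow_two (state c a ε n ω), key]
  simp only [Finset.mul_sum, ← Finset.sum_add_distrib, ← Finset.sum_sub_distrib]
  refine Finset.sum_congr rfl fun t _ => ?_
  ring

/-- Telescoping t·x_t·p_t: the forcing k·x of the drift meets x and leaves k∑x², while the noise in
x meets the predictable p and x and is negligible. -/
lemma smallL1_state_mul_drift (h : ErrorCondition μ ε G σ) (hc : 1 / 2 < c) (hθ : 1 / 2 < θ)
    (k a : ℝ) :
    SmallL1 μ (fun n ω =>
      (c + θ - 1) * ∑ t ∈ Finset.range n, state c a ε t ω * drift θ k c a ε t ω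
      - k * ∑ t ∈ Finset.range n, state c a ε t ω ^ 2) := by
  obtain ⟨C, hC0, hC⟩ := h.exists_integral_state_sq_le hc a
  obtain ⟨C', hC0', hC'⟩ := h.exists_integral_drift_sq_le hc hθ k a
  have hx2 : ∀ t, Integrable (fun ω => state c a ε t ω ^ 2) μ :=
    fun t => (h.memLp_state c a t).integrable_sq
  have hCabs : ∀ t : ℕ, ∫ ω, |state c a ε t ω ^ 2| ∂μ ≤ C / ((t : ℝ) + 1) := fun t => by
    simp_rw [abs_of_nonneg (sq_nonneg (state c a ε t _))]; exact hC t
  have hxp : ∀ t, Integrable (fun ω => state c a ε t ω * drift θ k c a ε t ω) μ :=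
    fun t => (h.memLp_state c a t).integrable_mul (h.memLp_drift θ k c a t)
  have hxpabs : ∀ t : ℕ, ∫ ω, |state c a ε t ω * drift θ k c a ε t ω| ∂μ ≤
      (C + C') / ((t : ℝ) + 1) := fun t => by
    rw [add_div]
    exact (integral_abs_mul_le (h.memLp_state c a t) (h.memLp_drift θ k c a t)).trans
      (add_le_add (hC t) (hC' t))
  have s1 := SmallL1.natCast_mul hxp hxpabs
  have s2 := SmallL1.sum_div hxp (by positivity) hxpabs
  have s3 := SmallL1.sum_div hx2 hC0 hCabs
  have s4 := h.smallL1_weighted (h.measurable_drift θ k c a) (h.memLp_drift θ k c a) hC0' hC'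
    (w := fun t => 1 - θ / ((t : ℝ) + 1)) (A := (1 + θ) ^ 2)
    fun t => sq_one_sub_div_le (by linarith) le_rfl t.cast_nonneg
  have s5 := h.smallL1_weighted (h.measurable_state c a) (h.memLp_state c a) hC0 hC
    (w := fun t => 1 / ((t : ℝ) + 1)) (A := 1)
    fun t => by
      rw [div_pow, one_pow]
      exact div_le_self zero_le_one (by nlinarith [(t.cast_nonneg : (0 : ℝ) ≤ t)])
  refine (((((s1.const_mul (-1)).add (s2.const_mul (c * θ))).add (s3.const_mul (-(c * k)))).add
    (s4.const_mul a)).add (s5.const_mul (a * k))).congr fun n ω => ?_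
  have key := natCast_mul_recur_mul_recur c θ 0 0 (fun s => a * ε (s + 1) ω)
    (fun s => k * state c a ε s ω) n
  change (n : ℝ) * (state c a ε n ω * drift θ k c a ε n ω) = ∑ t ∈ Finset.range n,
        ((1 - c - θ) * (state c a ε t ω * drift θ k c a ε t ω)
          + c * θ * (state c a ε t ω * drift θ k c a ε t ω / ((t : ℝ) + 1))
          + (1 - c / ((t : ℝ) + 1)) * (state c a ε t ω * (k * state c a ε t ω))
          + (1 - θ / ((t : ℝ) + 1)) * (drift θ k c a ε t ω * (a * ε (t + 1) ω))
          + a * ε (t + 1) ω * (k * state c a ε t ω) / ((t : ℝ) + 1)) at key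
  rw [key]
  simp only [Finset.mul_sum, ← Finset.sum_add_distrib, ← Finset.sum_sub_distrib]
  refine Finset.sum_congr rfl fun t _ => ?_
  ring

/-- Telescoping t·p_t²: no noise enters directly, and the forcing k·x meets p twice. -/
lemma smallL1_drift_sq (h : ErrorCondition μ ε G σ) (hc : 1 / 2 < c) (hθ : 1 / 2 < θ)
    (k a : ℝ) :
    SmallL1 μ (fun n ω =>
      (2 * θ - 1) * ∑ t ∈ Finset.range n, drift θ k c a ε t ω ^ 2
      - 2 * k * ∑ t ∈ Finset.range n, state c a ε t ω * drift θ k c a ε t ω) := by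
  obtain ⟨C, hC0, hC⟩ := h.exists_integral_state_sq_le hc a
  obtain ⟨C', hC0', hC'⟩ := h.exists_integral_drift_sq_le hc hθ k a
  have hx2 : ∀ t, Integrable (fun ω => state c a ε t ω ^ 2) μ :=
    fun t => (h.memLp_state c a t).integrable_sq
  have hCabs : ∀ t : ℕ, ∫ ω, |state c a ε t ω ^ 2| ∂μ ≤ C / ((t : ℝ) + 1) := fun t => by
    simp_rw [abs_of_nonneg (sq_nonneg (state c a ε t _))]; exact hC t
  have hp2 : ∀ t, Integrable (fun ω => drift θ k c a ε t ω ^ 2) μ :=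
    fun t => (h.memLp_drift θ k c a t).integrable_sq
  have hCabs' : ∀ t : ℕ, ∫ ω, |drift θ k c a ε t ω ^ 2| ∂μ ≤ C' / ((t : ℝ) + 1) := fun t => by
    simp_rw [abs_of_nonneg (sq_nonneg (drift θ k c a ε t _))]; exact hC' t
  have hxp : ∀ t, Integrable (fun ω => state c a ε t ω * drift θ k c a ε t ω) μ :=
    fun t => (h.memLp_state c a t).integrable_mul (h.memLp_drift θ k c a t)
  have hxpabs : ∀ t : ℕ, ∫ ω, |state c a ε t ω * drift θ k c a ε t ω| ∂μ ≤
      (C + C') / ((t : ℝ) + 1) := fun t => by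
    rw [add_div]
    exact (integral_abs_mul_le (h.memLp_state c a t) (h.memLp_drift θ k c a t)).trans
      (add_le_add (hC t) (hC' t))
  have s1 := SmallL1.natCast_mul hp2 hCabs'
  have s2 := SmallL1.sum_div hp2 hC0' hCabs'
  have s3 := SmallL1.sum_div hxp (by positivity) hxpabs
  have s4 := SmallL1.sum_div hx2 hC0 hCabs
  refine ((((s1.const_mul (-1)).add (s2.const_mul (θ ^ 2))).add (s3.const_mul (-(2 * θ * k)))).add
    (s4.const_mul (k ^ 2))).congr fun n ω => ?_
  have key := natCast_mul_recur_mul_recur θ θ 0 0 (fun s => k * state c a ε s ω)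
    (fun s => k * state c a ε s ω) n
  change (n : ℝ) * (drift θ k c a ε n ω * drift θ k c a ε n ω) = ∑ t ∈ Finset.range n,
        ((1 - θ - θ) * (drift θ k c a ε t ω * drift θ k c a ε t ω)
          + θ * θ * (drift θ k c a ε t ω * drift θ k c a ε t ω / ((t : ℝ) + 1))
          + (1 - θ / ((t : ℝ) + 1)) * (drift θ k c a ε t ω * (k * state c a ε t ω))
          + (1 - θ / ((t : ℝ) + 1)) * (drift θ k c a ε t ω * (k * state c a ε t ω))
          + k * state c a ε t ω * (k * state c a ε t ω) / ((t : ℝ) + 1)) at key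
  rw [pow_two (drift θ k c a ε n ω), key]
  simp only [Finset.mul_sum, ← Finset.sum_add_distrib, ← Finset.sum_sub_distrib]
  refine Finset.sum_congr rfl fun t _ => ?_
  ring

/-- The quadratic variation of the tracking error `l x + p` grows like `ln n`. -/
lemma smallL1_tracking_sq (h : ErrorCondition μ ε G σ) (hG : G 0 = ⊥) (hc : 1 / 2 < c)
    (hθ : 1 / 2 < θ) (k a l : ℝ) :
    SmallL1 μ (fun n ω =>
      ∑ t ∈ Finset.range n, (l * state c a ε t ω + drift θ k c a ε t ω) ^ 2
      - a ^ 2 * σ ^ 2 / (2 * c - 1) * (l ^ 2 + 2 * l * (k / (c + θ - 1))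
          + 2 * k / (2 * θ - 1) * (k / (c + θ - 1)))
        * ∑ t ∈ Finset.range n, 1 / ((t : ℝ) + 1)) := by
  have s1 := h.smallL1_state_sq hG hc a
  have s2 := h.smallL1_state_mul_drift hc hθ k a
  have s3 := h.smallL1_drift_sq hc hθ k a
  have h1 : c + θ - 1 ≠ 0 := by linarith
  have h2 : 2 * θ - 1 ≠ 0 := by linarith
  have h3 : 2 * c - 1 ≠ 0 := by linarith
  -- Back substitution in the triangular system: ∑p² is traded for ∑xp, the accumulated ∑xp for ∑x²,
  -- and the accumulated ∑x² for the harmonic sum.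
  refine (((s1.const_mul (l ^ 2 + 2 * l * (k / (c + θ - 1))
    + 2 * k / (2 * θ - 1) * (k / (c + θ - 1)))).add
    (s2.const_mul ((2 * l + 2 * k / (2 * θ - 1)) / (c + θ - 1)))).add
    (s3.const_mul (2 * θ - 1)⁻¹)).congr fun n ω => ?_
  have e : ∑ t ∈ Finset.range n, (l * state c a ε t ω + drift θ k c a ε t ω) ^ 2 =
      l ^ 2 * ∑ t ∈ Finset.range n, state c a ε t ω ^ 2
      + 2 * l * ∑ t ∈ Finset.range n, state c a ε t ω * drift θ k c a ε t ω
      + ∑ t ∈ Finset.range n, drift θ k c a ε t ω ^ 2 := by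
    simp only [Finset.mul_sum, ← Finset.sum_add_distrib]
    exact Finset.sum_congr rfl fun t _ => by ring
  rw [e]
  generalize ∑ t ∈ Finset.range n, state c a ε t ω ^ 2 = A
  generalize ∑ t ∈ Finset.range n, state c a ε t ω * drift θ k c a ε t ω = B
  generalize ∑ t ∈ Finset.range n, drift θ k c a ε t ω ^ 2 = E
  generalize ∑ t ∈ Finset.range n, 1 / ((t : ℝ) + 1) = H
  field_simp
  ring

end ErrorCondition

end ZeroStart

/-! ### Convergence in probability -/

section InProbability

variable {Ω : Type*} [mΩ : MeasurableSpace Ω] {μ : Measure Ω}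

lemma tendstoInMeasure_real_iff {X : ℕ → Ω → ℝ} {c : ℝ} :
    TendstoInMeasure μ X atTop (fun _ => c) ↔
      ∀ η : ℝ, 0 < η → Tendsto (fun n => μ {ω | η ≤ |X n ω - c|}) atTop (𝓝 0) := by
  simp only [tendstoInMeasure_iff_dist, Real.dist_eq]

lemma tendstoInMeasure_add_const {X Y : ℕ → Ω → ℝ} {a b : ℝ}
    (hX : TendstoInMeasure μ X atTop (fun _ => a)) (hY : TendstoInMeasure μ Y atTop (fun _ => b)) :
    TendstoInMeasure μ (fun n ω => X n ω + Y n ω) atTop (fun _ => a + b) := by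
  rw [tendstoInMeasure_real_iff] at *
  intro η hη
  have h := (hX (η / 2) (by positivity)).add (hY (η / 2) (by positivity))
  rw [add_zero] at h
  refine tendsto_of_tendsto_of_tendsto_of_le_of_le tendsto_const_nhds h (fun _ => zero_le)
    fun n => (measure_mono fun ω hω => ?_).trans (measure_union_le _ _)
  simp only [mem_ofPred_eq, mem_union] at hω ⊢
  by_contra! hcon
  have := abs_add_le (X n ω - a) (Y n ω - b)
  have e : X n ω - a + (Y n ω - b) = X n ω + Y n ω - (a + b) := by ring
  rw [e] at this
  linarith [hcon.1, hcon.2]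

lemma tendstoInMeasure_zero_of_abs_le {X Y : ℕ → Ω → ℝ}
    (hY : TendstoInMeasure μ Y atTop (fun _ => (0 : ℝ))) (h : ∀ n ω, |X n ω| ≤ |Y n ω|) :
    TendstoInMeasure μ X atTop (fun _ => (0 : ℝ)) := by
  rw [tendstoInMeasure_real_iff] at *
  intro η hη
  refine tendsto_of_tendsto_of_tendsto_of_le_of_le tendsto_const_nhds (hY η hη)
    (fun _ => zero_le) fun n => measure_mono fun ω hω => ?_
  simp only [mem_ofPred_eq, sub_zero] at hω ⊢
  exact hω.trans (h n ω)

lemma tendstoInMeasure_const_of_tendsto {v : ℕ → ℝ} {c : ℝ} (h : Tendsto v atTop (𝓝 c)) :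
    TendstoInMeasure μ (fun n (_ : Ω) => v n) atTop (fun _ => c) := by
  rw [tendstoInMeasure_real_iff]
  intro η hη
  refine tendsto_const_nhds.congr' ?_
  filter_upwards [(Metric.tendsto_nhds.1 h) η hη] with n hn
  rw [Real.dist_eq] at hn
  simp [not_le.2 hn]

/-- A real random variable is bounded by a constant up to small probability. -/
lemma exists_measure_abs_gt_le [IsFiniteMeasure μ] {K : Ω → ℝ} (hK : Measurable K) {η : ℝ≥0∞}
    (hη : 0 < η) : ∃ k : ℝ, 0 < k ∧ μ {ω | k < |K ω|} ≤ η := by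
  have ht : Tendsto (fun n : ℕ => μ {ω | (n : ℝ) < |K ω|}) atTop
      (𝓝 (μ (⋂ n : ℕ, {ω | (n : ℝ) < |K ω|}))) := by
    refine tendsto_measure_iInter_atTop (fun n => ?_) (fun i j hij ω hω => ?_)
      ⟨0, measure_ne_top _ _⟩
    · exact (measurableSet_lt measurable_const hK.abs).nullMeasurableSet
    · have : (i : ℝ) ≤ j := by exact_mod_cast hij
      exact lt_of_le_of_lt this hω
  have he : (⋂ n : ℕ, {ω | (n : ℝ) < |K ω|}) = ∅ := by
    ext ω
    simp only [mem_iInter, mem_ofPred_eq, mem_empty_iff_false, iff_false, not_forall, not_lt]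
    exact exists_nat_ge _
  rw [he, measure_empty] at ht
  obtain ⟨n, hn, hn0⟩ :=
    ((ENNReal.tendsto_nhds_zero.1 ht η hη).and (eventually_gt_atTop 0)).exists
  exact ⟨n, by exact_mod_cast hn0, hn⟩

/-- The factor K needs no moments: it is truncated at a level exceeded with small probability. -/
lemma tendstoInMeasure_zero_mul [IsFiniteMeasure μ] {K : Ω → ℝ} (hK : Measurable K)
    {X : ℕ → Ω → ℝ} (hX : TendstoInMeasure μ X atTop (fun _ => (0 : ℝ))) :
    TendstoInMeasure μ (fun n ω => K ω * X n ω) atTop (fun _ => (0 : ℝ)) := by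
  rw [tendstoInMeasure_real_iff] at *
  intro η hη
  rw [ENNReal.tendsto_nhds_zero]
  intro δ hδ
  obtain ⟨k, hk0, hk⟩ := exists_measure_abs_gt_le (μ := μ) hK (ENNReal.half_pos hδ.ne')
  filter_upwards [ENNReal.tendsto_nhds_zero.1 (hX (η / k) (by positivity)) _
    (ENNReal.half_pos hδ.ne')] with n hn
  calc μ {ω | η ≤ |K ω * X n ω - 0|}
      ≤ μ ({ω | k < |K ω|} ∪ {ω | η / k ≤ |X n ω - 0|}) := by
        refine measure_mono fun ω hω => ?_
        simp only [mem_ofPred_eq, mem_union, sub_zero] at hω ⊢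
        by_contra! hcon
        have h1 : |K ω| * |X n ω| < η := by
          calc |K ω| * |X n ω| ≤ k * |X n ω| :=
                mul_le_mul_of_nonneg_right hcon.1 (abs_nonneg _)
            _ < k * (η / k) := mul_lt_mul_of_pos_left hcon.2 hk0
            _ = η := by field_simp
        rw [abs_mul] at hω
        linarith
    _ ≤ δ / 2 + δ / 2 := (measure_union_le _ _).trans (add_le_add hk hn)
    _ = δ := ENNReal.add_halves δ

lemma measure_ge_le_div {Z : Ω → ℝ} (hZ : Integrable Z μ) {a : ℝ} (ha : 0 < a) :
    μ {ω | a ≤ |Z ω|} ≤ ENNReal.ofReal ((∫ ω, |Z ω| ∂μ) / a) := by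
  have h := meas_ge_le_lintegral_div (μ := μ) (f := fun ω => ENNReal.ofReal |Z ω|)
    hZ.abs.aemeasurable.ennreal_ofReal (ε := ENNReal.ofReal a) (by simpa using ha)
    ENNReal.ofReal_ne_top
  rw [← ofReal_integral_eq_lintegral_ofReal hZ.abs (ae_of_all _ fun ω => abs_nonneg _),
    ← ENNReal.ofReal_div_of_pos ha] at h
  refine le_trans (measure_mono fun ω hω => ?_) h
  exact ENNReal.ofReal_le_ofReal hω

lemma SmallL1.tendstoInMeasure {X : ℕ → Ω → ℝ} (hX : SmallL1 μ X) :
    TendstoInMeasure μ (fun (n : ℕ) ω => (Real.log n)⁻¹ * X n ω) atTop (fun _ => (0 : ℝ)) := by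
  rw [tendstoInMeasure_real_iff]
  intro η hη
  have h1 : Tendsto (fun n : ℕ => ENNReal.ofReal (((Real.log n)⁻¹ * ∫ ω, |X n ω| ∂μ) / η)) atTop
      (𝓝 0) := by
    simpa using ENNReal.tendsto_ofReal (hX.tendsto.div_const η)
  refine tendsto_of_tendsto_of_tendsto_of_le_of_le' tendsto_const_nhds h1
    (Eventually.of_forall fun _ => zero_le) ?_
  filter_upwards [eventually_log_pos] with n hn
  have := measure_ge_le_div ((hX.integrable n).const_mul (Real.log n)⁻¹) hη
  simp_rw [abs_mul, abs_of_pos (inv_pos.2 hn)] at this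
  rw [integral_const_mul] at this
  simpa [abs_mul, abs_of_pos hn] using this

/-- Sufficient condition for `L_n = O_p(ln n)`. -/
lemma isBigOpOne_of_abs_le [IsProbabilityMeasure μ] {X Z : ℕ → Ω → ℝ} {K : Ω → ℝ}
    (hK : Measurable K) (hZ : ∀ n, Integrable (Z n) μ) {C : ℝ} (hC : 0 ≤ C)
    (hZC : ∀ n : ℕ, ∫ ω, |Z n ω| ∂μ ≤ C * (1 + Real.log n)) (h : ∀ n ω, |X n ω| ≤ K ω + Z n ω) :
    IsBigOpOne μ (fun n ω => (Real.log n)⁻¹ * X n ω) := by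
  intro η hη
  obtain ⟨k, hk0, hk⟩ := exists_measure_abs_gt_le (μ := μ) hK
    (η := ENNReal.ofReal (η / 2)) (by simpa using hη)
  -- Once ln n ≥ 1, the mean is at most 2C·ln n, so Markov's inequality gives probability at most
  -- 2C/k₂ ≤ η/2; the summand 1 keeps k₂ positive when C = 0.
  set k₂ := (4 * C + 1) / η with hk₂
  have hk₂0 : 0 < k₂ := by positivity
  refine ⟨k + k₂, ?_⟩
  filter_upwards [tendsto_log_natCast.eventually_ge_atTop 1] with n hn
  have hn0 : 0 < Real.log n := by linarith
  have hsub : {ω | k + k₂ < |(Real.log n)⁻¹ * X n ω|} ⊆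
      {ω | k < |K ω|} ∪ {ω | k₂ * Real.log n ≤ |Z n ω|} := by
    intro ω hω
    simp only [mem_ofPred_eq, mem_union] at hω ⊢
    by_contra! hcon
    rw [abs_mul, abs_of_pos (inv_pos.2 hn0), inv_mul_eq_div, lt_div_iff₀ hn0] at hω
    have h1 := h n ω
    have h2 := le_abs_self (K ω)
    have h3 := le_abs_self (Z n ω)
    nlinarith [hcon.1, hcon.2]
  have hM := measure_ge_le_div (hZ n) (mul_pos hk₂0 hn0)
  have hle : (∫ ω, |Z n ω| ∂μ) / (k₂ * Real.log n) ≤ η / 2 := by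
    rw [div_le_iff₀ (by positivity)]
    have : η / 2 * (k₂ * Real.log n) = (4 * C + 1) / 2 * Real.log n := by
      rw [hk₂]; field_simp
    rw [this]
    refine (hZC n).trans ?_
    nlinarith
  calc _ ≤ _ := measure_mono hsub
    _ ≤ ENNReal.ofReal (η / 2) + ENNReal.ofReal (η / 2) :=
      (measure_union_le _ _).trans (add_le_add hk (hM.trans (ENNReal.ofReal_le_ofReal hle)))
    _ = ENNReal.ofReal η := by
      rw [← ENNReal.ofReal_add (by positivity) (by positivity), add_halves]

lemma SmallL1.sqrt [IsProbabilityMeasure μ] {A : ℕ → Ω → ℝ} (hA : ∀ n, Integrable (A n) μ)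
    (hA0 : ∀ n ω, 0 ≤ A n ω) {C : ℝ} (h : ∀ n : ℕ, ∫ ω, A n ω ∂μ ≤ C * (1 + Real.log n)) :
    SmallL1 μ (fun n ω => Real.sqrt (A n ω)) := by
  refine .of_integral_sq_le (fun n => ?_) (C := C) fun n => ?_
  · refine (memLp_two_iff_integrable_sq
      (Real.continuous_sqrt.comp_aestronglyMeasurable (hA n).aestronglyMeasurable)).2 ?_
    simpa [Real.sq_sqrt (hA0 n _)] using hA n
  · simpa [Real.sq_sqrt (hA0 n _)] using h n

/-- Consistency of minimizers from pointwise convergence and a stochastic Lipschitz condition. -/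
lemma tendstoInMeasure_argmin {lo hi θ₀ : ℝ} {Δ : ℕ → ℝ → Ω → ℝ}
    {D : ℝ → ℝ} {L : ℕ → Ω → ℝ}
    (hpt : ∀ θ ∈ Icc lo hi,
      TendstoInMeasure μ (fun (n : ℕ) ω => (Real.log n)⁻¹ * Δ n θ ω) atTop (fun _ => D θ))
    (hcont : ContinuousOn D (Icc lo hi))
    (hpos : ∀ θ ∈ Icc lo hi, θ ≠ θ₀ → 0 < D θ)
    (hL : IsBigOpOne μ (fun n ω => (Real.log n)⁻¹ * L n ω))
    (hlip : ∀ n, ∀ θ₁ ∈ Icc lo hi, ∀ θ₂ ∈ Icc lo hi, ∀ ω,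
      |Δ n θ₁ ω - Δ n θ₂ ω| ≤ |θ₁ - θ₂| * L n ω)
    {θhat : ℕ → Ω → ℝ} (hmem : ∀ n ω, θhat n ω ∈ Icc lo hi) (hmin : ∀ n ω, Δ n (θhat n ω) ω ≤ 0) :
    TendstoInMeasure μ θhat atTop (fun _ => θ₀) := by
  rw [tendstoInMeasure_real_iff]
  intro δ hδ
  set S := {θ | θ ∈ Icc lo hi ∧ δ ≤ |θ - θ₀|} with hS
  have hScomp : IsCompact S := by
    have : S = Icc lo hi ∩ {θ | δ ≤ |θ - θ₀|} := rfl
    rw [this]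
    exact isCompact_Icc.inter_right (isClosed_le continuous_const (by fun_prop))
  rcases S.eq_empty_or_nonempty with hemp | hne
  · have : ∀ n, {ω | δ ≤ |θhat n ω - θ₀|} = ∅ := by
      intro n
      ext ω
      simp only [mem_ofPred_eq, mem_empty_iff_false, iff_false]
      intro hω
      have : θhat n ω ∈ S := ⟨hmem n ω, hω⟩
      rw [hemp] at this
      exact this
    simp [this]
  obtain ⟨θm, hθm, hθmin⟩ := hScomp.exists_isMinOn hne (hcont.mono fun θ hθ => hθ.1)
  set m := D θm with hm
  have hm0 : 0 < m := hpos θm hθm.1 fun e => by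
    have := hθm.2
    rw [e, sub_self, abs_zero] at this
    linarith
  rw [ENNReal.tendsto_nhds_zero]
  intro η hη
  obtain ⟨η', hη'0, hη'⟩ : ∃ η' : ℝ, 0 < η' ∧ ENNReal.ofReal η' ≤ η / 2 := by
    rcases eq_or_ne η ∞ with rfl | htop
    · exact ⟨1, one_pos, by simp [ENNReal.top_div_of_ne_top]⟩
    · have h2 : η / 2 ≠ ∞ := (ENNReal.div_lt_top htop two_ne_zero).ne
      exact ⟨(η / 2).toReal, ENNReal.toReal_pos (ENNReal.half_pos hη.ne').ne' h2,
        (ENNReal.ofReal_toReal h2).le⟩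
  obtain ⟨K, hK⟩ := hL η' hη'0
  -- Radius at which the Lipschitz bound, with constant at most |K|+1, allows an oscillation of at
  -- most m/2.
  set r := m / (2 * (|K| + 1)) with hr
  have hr0 : 0 < r := by positivity
  obtain ⟨t, htS, htfin, htcov⟩ := hScomp.finite_cover_balls hr0
  lift t to Finset ℝ using htfin
  have hsum : Tendsto (fun n : ℕ =>
      ∑ θ ∈ t, μ {ω | m / 2 ≤ |(Real.log n)⁻¹ * Δ n θ ω - D θ|}) atTop (𝓝 0) := by
    have := tendsto_finsetSum t fun θ (hθ : θ ∈ t) =>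
      tendstoInMeasure_real_iff.1 (hpt θ (htS hθ).1) (m / 2) (by positivity)
    simpa using this
  filter_upwards [hK, eventually_log_pos,
    ENNReal.tendsto_nhds_zero.1 hsum _ (ENNReal.half_pos hη.ne')] with n hn hlog hn2
  -- If the minimizer is far from θ₀ and the Lipschitz constant is under control, a net point near
  -- the minimizer has normalized criterion at most m/2, although its limit is at least m: pointwise
  -- convergence fails there by m/2.
  have hsub : {ω | δ ≤ |θhat n ω - θ₀|} ⊆ {ω | K < |(Real.log n)⁻¹ * L n ω|} ∪
      ⋃ θ ∈ t, {ω | m / 2 ≤ |(Real.log n)⁻¹ * Δ n θ ω - D θ|} := by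
    intro ω hω
    by_cases hLω : K < |(Real.log n)⁻¹ * L n ω|
    · exact Or.inl hLω
    refine Or.inr ?_
    have hmemS : θhat n ω ∈ S := ⟨hmem n ω, hω⟩
    have hc := htcov hmemS
    simp only [mem_iUnion, Metric.mem_ball, Real.dist_eq, exists_prop] at hc
    obtain ⟨θ, hθt, hθr⟩ := hc
    have hθS := htS hθt
    simp only [mem_iUnion, mem_ofPred_eq, exists_prop]
    refine ⟨θ, hθt, ?_⟩
    have h1 := hlip n θ hθS.1 (θhat n ω) (hmem n ω) ω
    have h2 := hmin n ω
    have h3 : m ≤ D θ := hθmin hθS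
    have h4 : (Real.log n)⁻¹ * Δ n θ ω ≤ |θ - θhat n ω| * ((Real.log n)⁻¹ * L n ω) := by
      have h5 : Δ n θ ω ≤ |θ - θhat n ω| * L n ω := by
        linarith [le_abs_self (Δ n θ ω - Δ n (θhat n ω) ω)]
      calc _ ≤ (Real.log n)⁻¹ * (|θ - θhat n ω| * L n ω) :=
            mul_le_mul_of_nonneg_left h5 (inv_nonneg.2 hlog.le)
        _ = _ := by ring
    have h6 : |θ - θhat n ω| * ((Real.log n)⁻¹ * L n ω) ≤ r * (|K| + 1) := by
      have h7 : (Real.log n)⁻¹ * L n ω ≤ |K| + 1 := by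
        linarith [le_abs_self ((Real.log n)⁻¹ * L n ω), le_abs_self K, not_lt.1 hLω]
      have h8 : |θ - θhat n ω| ≤ r := by rw [abs_sub_comm]; exact hθr.le
      calc _ ≤ |θ - θhat n ω| * (|K| + 1) := mul_le_mul_of_nonneg_left h7 (abs_nonneg _)
        _ ≤ _ := mul_le_mul_of_nonneg_right h8 (by positivity)
    have h9 : r * (|K| + 1) = m / 2 := by
      rw [hr]; field_simp
    rw [abs_sub_comm]
    exact le_trans (by linarith) (le_abs_self _)
  calc μ {ω | δ ≤ |θhat n ω - θ₀|} ≤ _ := measure_mono hsub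
    _ ≤ μ {ω | K < |(Real.log n)⁻¹ * L n ω|} +
        μ (⋃ θ ∈ t, {ω | m / 2 ≤ |(Real.log n)⁻¹ * Δ n θ ω - D θ|}) := measure_union_le _ _
    _ ≤ η / 2 + η / 2 :=
      add_le_add (hn.trans hη') ((measure_biUnion_finset_le _ _).trans hn2)
    _ = η := ENNReal.add_halves η

end InProbability

/-! ### The effect of the initial values -/

/-- In contrast with `abs_le_of_sq_le_mul`, the random quantity A enters through its square root,
which is o(ln n) when A is of order ln n. -/
lemma abs_le_sqrt_mul {a A K : ℝ} (hA : 0 ≤ A) (hK : 0 ≤ K) (h : a ^ 2 ≤ A * K) :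
    |a| ≤ Real.sqrt A * (1 + K) := by
  apply abs_le_of_sq_le_sq _ (by positivity)
  rw [mul_pow, Real.sq_sqrt hA]
  exact h.trans (mul_le_mul_of_nonneg_left (by nlinarith) hA)

set_option maxHeartbeats 1000000 in
-- The initial values x₀ and p₀ are confined to one polynomial factor, and the other factor does not
-- involve them. Since p₀ may depend on the whole path of u, the error sum against its response is
-- bounded by Abel summation. The response to x₀ in the centred path is x₀ times a deterministic
-- square-summable sequence, so its error sum is kept explicit.
lemma exists_abs_excess_add_sub_le {c θ : ℝ} (hc : 1 / 2 < c) (hθ : 1 / 2 < θ) (k l : ℝ) :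
    ∃ C : ℝ, 0 ≤ C ∧ ∀ (u w : ℕ → ℝ) (x₀ p₀ : ℝ) (n : ℕ),
      |excess u (fun t => w t + (l * (x₀ * recur c 1 (fun _ => 0) t)
          + recur θ p₀ (fun s => k * (x₀ * recur c 1 (fun _ => 0) s)) t)) n - excess u w n| ≤
        C * (1 + x₀ ^ 2 + p₀ ^ 2) * (1 + Real.sqrt (∑ t ∈ Finset.range n, w t ^ 2)
          + |∑ t ∈ Finset.range n, recur c 1 (fun _ => 0) t * u (t + 1)|
          + Real.sqrt (∑ t ∈ Finset.range n, tailSum u n t ^ 2)) := by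
  set ρ := recur c 1 (fun _ => 0) with hρ
  obtain ⟨Cρ, hCρ0, hCρ⟩ := exists_sum_sq_le (B := c) hc
  obtain ⟨H, hH0, hH⟩ := exists_sum_sq_le (B := θ) hθ
  obtain ⟨A, hA0, hA⟩ := exists_sq_sum_mul_le (B := θ) hθ
  have hρsum : ∀ n, ∑ t ∈ Finset.range n, ρ t ^ 2 ≤ Cρ := fun n => by
    have := hCρ c (left_mem_Icc.2 le_rfl) ρ (fun _ => 0) (fun t => rfl) n
    have h0 : ρ 0 = 1 := rfl
    simpa [h0] using this
  set F := 1 + k ^ 2 * Cρ with hF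
  have hF1 : 1 ≤ F := by rw [hF]; have : 0 ≤ k ^ 2 * Cρ := by positivity
                         linarith
  set E := 2 * l ^ 2 * Cρ + 2 * H * F with hE
  have hE0 : 0 ≤ E := by positivity
  refine ⟨2 * (1 + E) + E + 2 * (|l| + (1 + A * F)), by positivity, fun u w x₀ p₀ n => ?_⟩
  set f : ℕ → ℝ := fun s => k * (x₀ * ρ s) with hf
  set e := recur θ p₀ f with he
  set R := ∑ t ∈ Finset.range n, tailSum u n t ^ 2 with hR
  set W := ∑ t ∈ Finset.range n, w t ^ 2 with hW
  have hR0 : 0 ≤ R := Finset.sum_nonneg fun _ _ => sq_nonneg _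
  have hW0 : 0 ≤ W := Finset.sum_nonneg fun _ _ => sq_nonneg _
  set s := x₀ ^ 2 + p₀ ^ 2 with hs
  have hs0 : 0 ≤ s := by positivity
  have he0 : e 0 = p₀ := rfl
  have hdrive : e 0 ^ 2 + ∑ t ∈ Finset.range n, f t ^ 2 ≤ F * s := by
    have h1 : ∑ t ∈ Finset.range n, f t ^ 2 = k ^ 2 * x₀ ^ 2 * ∑ t ∈ Finset.range n, ρ t ^ 2 := by
      rw [Finset.mul_sum]
      exact Finset.sum_congr rfl fun t _ => by rw [hf]; ring
    have h2 : k ^ 2 * x₀ ^ 2 * ∑ t ∈ Finset.range n, ρ t ^ 2 ≤ k ^ 2 * x₀ ^ 2 * Cρ :=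
      mul_le_mul_of_nonneg_left (hρsum n) (by positivity)
    have h3 : 0 ≤ k ^ 2 * Cρ * p₀ ^ 2 := by positivity
    rw [he0, h1, hF, hs]
    nlinarith [sq_nonneg x₀]
  have hesum : ∑ t ∈ Finset.range n, e t ^ 2 ≤ H * (F * s) :=
    (hH θ (left_mem_Icc.2 le_rfl) e f (fun t => rfl) n).trans
      (mul_le_mul_of_nonneg_left hdrive hH0)
  have hue : |∑ t ∈ Finset.range n, u (t + 1) * e t| ≤ Real.sqrt R * (1 + A * (F * s)) :=
    abs_le_sqrt_mul hR0 (by positivity)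
      ((hA θ (left_mem_Icc.2 le_rfl) e f (fun t => rfl) u n).trans
        (mul_le_mul_of_nonneg_left (mul_le_mul_of_nonneg_left hdrive hA0) hR0))
  set e' : ℕ → ℝ := fun t => l * (x₀ * ρ t) + e t with he'
  have he'sum : ∑ t ∈ Finset.range n, e' t ^ 2 ≤ E * s := by
    have h1 := sum_add_sq_le (fun t => l * (x₀ * ρ t)) e n
    have h2 : ∑ t ∈ Finset.range n, (l * (x₀ * ρ t)) ^ 2 =
        l ^ 2 * x₀ ^ 2 * ∑ t ∈ Finset.range n, ρ t ^ 2 := by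
      rw [Finset.mul_sum]
      exact Finset.sum_congr rfl fun t _ => by ring
    have h3 : l ^ 2 * x₀ ^ 2 * ∑ t ∈ Finset.range n, ρ t ^ 2 ≤ l ^ 2 * s * Cρ :=
      mul_le_mul (mul_le_mul_of_nonneg_left (by rw [hs]; linarith [sq_nonneg p₀]) (sq_nonneg _))
        (hρsum n) (Finset.sum_nonneg fun _ _ => sq_nonneg _) (by positivity)
    have h4 : E * s = 2 * (l ^ 2 * s * Cρ) + 2 * (H * (F * s)) := by rw [hE]; ring
    rw [h4]
    linarith
  have hwe : |∑ t ∈ Finset.range n, w t * e' t| ≤ Real.sqrt W * (1 + E * s) :=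
    abs_le_sqrt_mul hW0 (by positivity) ((Finset.sum_mul_sq_le_sq_mul_sq _ _ _).trans
      (mul_le_mul_of_nonneg_left he'sum hW0))
  set Y := ∑ t ∈ Finset.range n, ρ t * u (t + 1) with hY
  have hmain : excess u (fun t => w t + e' t) n - excess u w n =
      2 * ∑ t ∈ Finset.range n, w t * e' t + ∑ t ∈ Finset.range n, e' t ^ 2
        + 2 * (l * x₀ * Y) + 2 * ∑ t ∈ Finset.range n, u (t + 1) * e t := by
    simp only [excess, hY, Finset.mul_sum, ← Finset.sum_add_distrib, ← Finset.sum_sub_distrib]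
    exact Finset.sum_congr rfl fun t _ => by simp only [he']; ring
  have hx₀ : |x₀| ≤ 1 + s := by
    rw [hs]; nlinarith [sq_nonneg (|x₀| - 1), sq_abs x₀, sq_nonneg p₀, abs_nonneg x₀]
  have hlY : |l * x₀ * Y| ≤ |l| * (1 + s) * |Y| := by
    rw [abs_mul, abs_mul]
    gcongr
  have he'0 : 0 ≤ ∑ t ∈ Finset.range n, e' t ^ 2 := Finset.sum_nonneg fun _ _ => sq_nonneg _
  have htri : |excess u (fun t => w t + e' t) n - excess u w n| ≤
      2 * (Real.sqrt W * (1 + E * s)) + E * s + 2 * (|l| * (1 + s) * |Y|)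
        + 2 * (Real.sqrt R * (1 + A * (F * s))) := by
    rw [hmain, abs_le]
    obtain ⟨a1, a2⟩ := abs_le.1 hwe
    obtain ⟨b1, b2⟩ := abs_le.1 hlY
    obtain ⟨c1, c2⟩ := abs_le.1 hue
    constructor <;> linarith
  refine htri.trans ?_
  have e1 : 1 + x₀ ^ 2 + p₀ ^ 2 = 1 + s := by rw [hs]; ring
  rw [e1]
  set sW := Real.sqrt W with hsW
  set sR := Real.sqrt R with hsR
  have hsW0 : 0 ≤ sW := Real.sqrt_nonneg _
  have hsR0 : 0 ≤ sR := Real.sqrt_nonneg _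
  have hY0 : 0 ≤ |Y| := abs_nonneg _
  have hl0 : 0 ≤ |l| := abs_nonneg _
  have q1 : sW * (1 + E * s) ≤ (1 + E) * (1 + s) * sW := by
    have : 1 + E * s ≤ (1 + E) * (1 + s) := by nlinarith
    rw [mul_comm]
    exact mul_le_mul_of_nonneg_right this hsW0
  have hAF : 0 ≤ A * F := by positivity
  have q2 : sR * (1 + A * (F * s)) ≤ (1 + A * F) * (1 + s) * sR := by
    have : 1 + A * (F * s) ≤ (1 + A * F) * (1 + s) := by nlinarith
    rw [mul_comm]
    exact mul_le_mul_of_nonneg_right this hsR0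
  have q3 : E * s ≤ E * (1 + s) := by nlinarith
  set B := 1 + sW + |Y| + sR with hB
  have h1s : 0 ≤ 1 + s := by positivity
  have r1 : (1 + E) * (1 + s) * sW ≤ (1 + E) * (1 + s) * B :=
    mul_le_mul_of_nonneg_left (by linarith) (by positivity)
  have r2 : (1 + A * F) * (1 + s) * sR ≤ (1 + A * F) * (1 + s) * B :=
    mul_le_mul_of_nonneg_left (by linarith) (by positivity)
  have r3 : E * (1 + s) ≤ E * (1 + s) * B :=
    le_mul_of_one_le_right (by positivity) (by linarith)
  have r4 : |l| * (1 + s) * |Y| ≤ |l| * (1 + s) * B :=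
    mul_le_mul_of_nonneg_left (by linarith) (by positivity)
  linarith

/-! ### Moments of the tail sums of the measurement errors -/

section TailSum

variable {Ω : Type*} [mΩ : MeasurableSpace Ω] {μ : Measure Ω} [IsProbabilityMeasure μ]
  {u : ℕ → Ω → ℝ} {G : ℕ → MeasurableSpace Ω} {σ : ℝ}

lemma tailSum_eq_sum_range (u : ℕ → ℝ) (n t : ℕ) :
    tailSum u n t =
      ∑ j ∈ Finset.range n, (if t ≤ j then 1 / ((j : ℝ) + 1) else 0) * u (j + 1) := by
  simp_rw [ite_mul, zero_mul]
  rw [← Finset.sum_filter, tailSum]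
  refine Finset.sum_congr ?_ fun j _ => by ring
  ext j
  simp [and_comm]

/-- By orthogonality each tail has second moment σ²∑_{j≥t} 1/(j+1)². After exchanging the sums,
index j is counted j+1 times, which leaves the harmonic sum. -/
lemma ErrorCondition.integral_sum_tailSum_sq (h : ErrorCondition μ u G σ) (n : ℕ) :
    Integrable (fun ω => ∑ t ∈ Finset.range n, tailSum (fun s => u s ω) n t ^ 2) μ ∧
    ∫ ω, ∑ t ∈ Finset.range n, tailSum (fun s => u s ω) n t ^ 2 ∂μ =
      σ ^ 2 * ∑ t ∈ Finset.range n, 1 / ((t : ℝ) + 1) := by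
  have hi : ∀ t, Integrable (fun ω => tailSum (fun s => u s ω) n t ^ 2) μ := fun t => by
    simp_rw [tailSum_eq_sum_range]
    exact (h.memLp_sum (g := fun j _ => if t ≤ j then 1 / ((j : ℝ) + 1) else 0)
      (fun _ => measurable_const) (fun _ => memLp_const _) n).integrable_sq
  refine ⟨integrable_finsetSum _ fun t _ => hi t, ?_⟩
  rw [integral_finsetSum _ fun t _ => hi t]
  have h1 : ∀ t, ∫ ω, tailSum (fun s => u s ω) n t ^ 2 ∂μ =
      σ ^ 2 * ∑ j ∈ Finset.range n, if t ≤ j then 1 / ((j : ℝ) + 1) ^ 2 else 0 := fun t => by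
    simp_rw [tailSum_eq_sum_range]
    rw [h.integral_sq_sum (g := fun j _ => if t ≤ j then 1 / ((j : ℝ) + 1) else 0)
      (fun _ => measurable_const) (fun _ => memLp_const _) n]
    congr 1
    refine Finset.sum_congr rfl fun j _ => ?_
    split_ifs <;> simp
  simp_rw [h1]
  rw [← Finset.mul_sum, Finset.sum_comm]
  congr 1
  refine Finset.sum_congr rfl fun j hj => ?_
  rw [← Finset.sum_filter, Finset.sum_const]
  have hcard : ((Finset.range n).filter (· ≤ j)).card = j + 1 := by
    have : (Finset.range n).filter (· ≤ j) = Finset.range (j + 1) := by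
      ext t
      simp only [Finset.mem_filter, Finset.mem_range] at hj ⊢
      omega
    rw [this, Finset.card_range]
  rw [hcard, nsmul_eq_mul]
  push_cast
  field_simp

end TailSum

/-! ### Reduction of the model to linear recursions -/

namespace Model

variable {Ω : Type*} (M : Model Ω)

/-- The learning path centred at the rational expectations equilibrium. -/
noncomputable def centred (t : ℕ) (ω : Ω) : ℝ := M.a t ω - M.δ₀ / (1 - M.β₀)

/-- The tracking error between the true path and the path with candidate gain `θ`. -/
noncomputable def gap (ini : Ω → ℝ) (θ : ℝ) (t : ℕ) (ω : Ω) : ℝ :=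
  M.a t ω - learn (fun s => M.y s ω) θ (ini ω) t

/-- The part of the tracking error not proportional to the centred path. -/
noncomputable def gapDrift (ini : Ω → ℝ) (θ : ℝ) (t : ℕ) (ω : Ω) : ℝ :=
  M.gap ini θ t ω - (M.θ₀ - θ) / M.θ₀ * M.centred t ω

lemma centred_succ (hβ : 1 - M.β₀ ≠ 0) (t : ℕ) (ω : Ω) :
    M.centred (t + 1) ω = (1 - M.θ₀ * (1 - M.β₀) / ((t : ℝ) + 1)) * M.centred t ω
      + M.θ₀ * M.ε (t + 1) ω / ((t : ℝ) + 1) := by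
  have : (t : ℝ) + 1 ≠ 0 := by positivity
  simp only [centred, a]
  field_simp
  ring

lemma centred_eq (hβ : 1 - M.β₀ ≠ 0) (t : ℕ) (ω : Ω) :
    M.centred t ω = M.centred 0 ω * recur (M.θ₀ * (1 - M.β₀)) 1 (fun _ => 0) t
      + state (M.θ₀ * (1 - M.β₀)) M.θ₀ M.ε t ω := by
  rw [eq_recur (p := fun t => M.centred t ω) (fun t => M.centred_succ hβ t ω), state,
    ← recur_mul, ← recur_add]
  simp

/-- Both the tracking error and the centred path are driven by y_{t+1} - a_t, with gains θ₀-θ and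
θ₀. The multiple (θ₀-θ)/θ₀ is the one for which this common innovation cancels. -/
lemma gapDrift_succ (hθ₀ : M.θ₀ ≠ 0) (hβ : 1 - M.β₀ ≠ 0) (ini : Ω → ℝ) (θ : ℝ) (t : ℕ) (ω : Ω) :
    M.gapDrift ini θ (t + 1) ω = (1 - θ / ((t : ℝ) + 1)) * M.gapDrift ini θ t ω
      + -(θ * ((M.θ₀ - θ) / M.θ₀)) * M.centred t ω / ((t : ℝ) + 1) := by
  have : (t : ℝ) + 1 ≠ 0 := by positivity
  simp only [gapDrift, gap, centred, a, learn, y, Nat.add_sub_cancel]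
  field_simp
  ring

lemma gap_eq (ini : Ω → ℝ) (θ : ℝ) (t : ℕ) (ω : Ω) :
    M.gap ini θ t ω = (M.θ₀ - θ) / M.θ₀ * M.centred t ω + M.gapDrift ini θ t ω := by
  rw [gapDrift]; ring

lemma gapDrift_zero (ini : Ω → ℝ) (θ : ℝ) (ω : Ω) :
    M.gapDrift ini θ 0 ω = (M.a₀ ω - ini ω) - (M.θ₀ - θ) / M.θ₀ * M.centred 0 ω := rfl

/-- The first bracket is adapted with controlled moments; the second depends on the initial values
alone. -/
lemma gap_eq_zeroStart_add (hθ₀ : M.θ₀ ≠ 0) (hβ : 1 - M.β₀ ≠ 0) (ini : Ω → ℝ) (θ : ℝ) (t : ℕ)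
    (ω : Ω) :
    M.gap ini θ t ω =
      ((M.θ₀ - θ) / M.θ₀ * state (M.θ₀ * (1 - M.β₀)) M.θ₀ M.ε t ω
        + drift θ (-(θ * ((M.θ₀ - θ) / M.θ₀))) (M.θ₀ * (1 - M.β₀)) M.θ₀ M.ε t ω)
      + ((M.θ₀ - θ) / M.θ₀
          * (M.centred 0 ω * recur (M.θ₀ * (1 - M.β₀)) 1 (fun _ => 0) t)
        + recur θ (M.gapDrift ini θ 0 ω) (fun s => -(θ * ((M.θ₀ - θ) / M.θ₀))
          * (M.centred 0 ω * recur (M.θ₀ * (1 - M.β₀)) 1 (fun _ => 0) s)) t) := by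
  have hdrift : M.gapDrift ini θ t ω =
      drift θ (-(θ * ((M.θ₀ - θ) / M.θ₀))) (M.θ₀ * (1 - M.β₀)) M.θ₀ M.ε t ω
      + recur θ (M.gapDrift ini θ 0 ω) (fun s => -(θ * ((M.θ₀ - θ) / M.θ₀))
          * (M.centred 0 ω * recur (M.θ₀ * (1 - M.β₀)) 1 (fun _ => 0) s)) t := by
    rw [eq_recur (p := fun t => M.gapDrift ini θ t ω)
      (fun t => M.gapDrift_succ hθ₀ hβ ini θ t ω), drift, ← recur_add, zero_add]
    congr 1
    funext s
    rw [M.centred_eq hβ s ω]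
    ring
  rw [gap_eq, hdrift, M.centred_eq hβ t ω]
  ring

lemma Q_eq (ini : Ω → ℝ) (n : ℕ) (θ : ℝ) (ω : Ω) :
    M.Q ini n θ ω = excess (fun s => M.u s ω) (fun t => M.gap ini θ t ω) n
      + ∑ t ∈ Finset.range n, M.u (t + 1) ω ^ 2 := by
  rw [Q, excess, Finset.range_eq_Ico, Finset.mul_sum, ← Finset.sum_add_distrib,
    ← Finset.sum_add_distrib]
  have : Finset.Icc 1 n = Finset.Ico (0 + 1) (n + 1) := by ext; simp
  rw [this, ← Finset.sum_Ico_add' _ 0 n 1]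
  refine Finset.sum_congr rfl fun t _ => ?_
  simp only [z, gap, Nat.add_sub_cancel]
  ring

lemma Dn_eq (ini : Ω → ℝ) (n : ℕ) (θ : ℝ) (ω : Ω) :
    M.Dn ini n θ ω = excess (fun s => M.u s ω) (fun t => M.gap ini θ t ω) n
      - excess (fun s => M.u s ω) (fun t => M.gap ini M.θ₀ t ω) n := by
  rw [Dn, Q_eq, Q_eq]; ring

lemma F_zero : M.F 0 = ⊥ := by simp [F]

/-- As θ₀ ≠ 0, each structural error can be recovered from two consecutive values of the true path.
Functions of past ε are thus admissible weights in martingale transforms by u. -/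
lemma F_le_I (hθ₀ : M.θ₀ ≠ 0) (t : ℕ) : M.F t ≤ M.I t := by
  refine iSup₂_le fun j hj => ?_
  obtain ⟨s, rfl⟩ : ∃ s, j = s + 1 := ⟨j - 1, by have := hj.1; omega⟩
  have ha : ∀ r ≤ t, Measurable[M.I t] (M.a r) := fun r hr => by
    refine Measurable.mono (comap_measurable _) ?_ le_rfl
    exact le_trans (le_iSup₂_of_le (f := fun j (_ : j ∈ Icc 0 t) =>
      MeasurableSpace.comap (M.a j) inferInstance) r ⟨r.zero_le, hr⟩ le_rfl) le_sup_right
  have e : M.ε (s + 1) = fun ω => (M.a (s + 1) ω - M.a s ω) * (((s : ℝ) + 1) / M.θ₀)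
      + M.a s ω - M.δ₀ - M.β₀ * M.a s ω := by
    funext ω
    have : (s : ℝ) + 1 ≠ 0 := by positivity
    simp only [a]
    field_simp
    ring
  rw [← measurable_iff_comap_le, e]
  have h1 := ha (s + 1) hj.2
  have h0 := ha s (by have := hj.2; omega)
  exact ((((h1.sub h0).mul_const _).add h0).sub_const _).sub (h0.const_mul _)

section Probability

variable [mΩ : MeasurableSpace Ω] {μ : Measure Ω} {M} {σε σu : ℝ}

lemma integral_sum_sq_le_log {w : ℕ → Ω → ℝ} (hw : ∀ t, MemLp (w t) 2 μ) {C : ℝ} (hC0 : 0 ≤ C)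
    (hC : ∀ t : ℕ, ∫ ω, w t ω ^ 2 ∂μ ≤ C / ((t : ℝ) + 1)) (n : ℕ) :
    ∫ ω, ∑ t ∈ Finset.range n, w t ω ^ 2 ∂μ ≤ C * (1 + Real.log n) := by
  rw [integral_finsetSum _ fun t _ => (hw t).integrable_sq]
  calc ∑ t ∈ Finset.range n, ∫ ω, w t ω ^ 2 ∂μ
      ≤ ∑ t ∈ Finset.range n, C * (1 / ((t : ℝ) + 1)) :=
        Finset.sum_le_sum fun t _ => (hC t).trans (le_of_eq (by ring))
    _ ≤ _ := by
        rw [← Finset.mul_sum]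
        exact mul_le_mul_of_nonneg_left (sum_one_div_le n) hC0

lemma measurable_a (hε : ErrorCondition μ M.ε M.F σε) (ha₀ : Measurable M.a₀) (t : ℕ) :
    Measurable (M.a t) := by
  induction t with
  | zero => exact ha₀
  | succ t ih =>
    have := hε.measurable t
    unfold a
    fun_prop

lemma measurable_envelope (hε : ErrorCondition μ M.ε M.F σε)
    (hu : ErrorCondition μ M.u M.I σu) (ha₀ : Measurable M.a₀) {ini : Ω → ℝ}
    (hini : Measurable ini) (n : ℕ) :
    Measurable fun ω => envelope (fun s => M.u s ω) (fun t => M.centred t ω)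
      (M.a₀ ω - ini ω) n := by
  have hx : ∀ t, Measurable fun ω => M.centred t ω := fun t =>
    (measurable_a hε ha₀ t).sub_const _
  have hu' := hu.measurable
  unfold envelope tailSum
  fun_prop

variable [IsProbabilityMeasure μ]

lemma exists_integral_tracking_sq_le (hε : ErrorCondition μ M.ε M.F σε) {c θ : ℝ}
    (hc : 1 / 2 < c) (hθ : 1 / 2 < θ) (k a l : ℝ) :
    ∃ C : ℝ, 0 ≤ C ∧ ∀ t : ℕ,
      ∫ ω, (l * state c a M.ε t ω + drift θ k c a M.ε t ω) ^ 2 ∂μ ≤ C / ((t : ℝ) + 1) := by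
  obtain ⟨C, hC0, hC⟩ := hε.exists_integral_state_sq_le hc a
  obtain ⟨C', hC0', hC'⟩ := hε.exists_integral_drift_sq_le hc hθ k a
  refine ⟨2 * l ^ 2 * C + 2 * C', by positivity, fun t => ?_⟩
  have hx := (hε.memLp_state c a t).integrable_sq
  have hp := (hε.memLp_drift θ k c a t).integrable_sq
  have hw := (((hε.memLp_state c a t).const_mul l).add (hε.memLp_drift θ k c a t)).integrable_sq
  calc ∫ ω, (l * state c a M.ε t ω + drift θ k c a M.ε t ω) ^ 2 ∂μ
      ≤ ∫ ω, (2 * l ^ 2 * state c a M.ε t ω ^ 2 + 2 * drift θ k c a M.ε t ω ^ 2) ∂μ := by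
        refine integral_mono hw ((hx.const_mul _).add (hp.const_mul _)) fun ω => ?_
        have := add_sq_le (a := l * state c a M.ε t ω) (b := drift θ k c a M.ε t ω)
        change (l * state c a M.ε t ω + drift θ k c a M.ε t ω) ^ 2 ≤
          2 * l ^ 2 * state c a M.ε t ω ^ 2 + 2 * drift θ k c a M.ε t ω ^ 2
        linarith
    _ = 2 * l ^ 2 * ∫ ω, state c a M.ε t ω ^ 2 ∂μ + 2 * ∫ ω, drift θ k c a M.ε t ω ^ 2 ∂μ := by
        rw [integral_add (hx.const_mul _) (hp.const_mul _), integral_const_mul, integral_const_mul]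
    _ ≤ 2 * l ^ 2 * (C / ((t : ℝ) + 1)) + 2 * (C' / ((t : ℝ) + 1)) :=
        add_le_add (mul_le_mul_of_nonneg_left (hC t) (by positivity))
          (mul_le_mul_of_nonneg_left (hC' t) (by positivity))
    _ = _ := by ring

lemma exists_integral_sq_sum_recur_mul_le (hu : ErrorCondition μ M.u M.I σu) {c : ℝ}
    (hc : 1 / 2 < c) :
    (∀ n, MemLp (fun ω => ∑ t ∈ Finset.range n, recur c 1 (fun _ => 0) t * M.u (t + 1) ω) 2 μ) ∧
    ∃ C : ℝ, 0 ≤ C ∧ (∀ n, ∑ t ∈ Finset.range n, recur c 1 (fun _ => 0) t ^ 2 ≤ C) ∧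
      ∀ n, ∫ ω, (∑ t ∈ Finset.range n, recur c 1 (fun _ => 0) t * M.u (t + 1) ω) ^ 2 ∂μ ≤
        σu ^ 2 * C := by
  obtain ⟨C, hC0, hC⟩ := exists_sum_sq_le (B := c) hc
  have hρ : ∀ n, ∑ t ∈ Finset.range n, recur c 1 (fun _ => 0) t ^ 2 ≤ C := fun n => by
    have := hC c (left_mem_Icc.2 le_rfl) (recur c 1 (fun _ => 0)) (fun _ => 0) (fun t => rfl) n
    have h0 : recur c 1 (fun _ => 0) 0 = 1 := rfl
    simpa [h0] using this
  refine ⟨fun n => hu.memLp_sum (g := fun t _ => recur c 1 (fun _ => 0) t)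
    (fun _ => measurable_const) (fun _ => memLp_const _) n, C, hC0, hρ, fun n => ?_⟩
  rw [hu.integral_sq_sum (g := fun t _ => recur c 1 (fun _ => 0) t)
    (fun _ => measurable_const) (fun _ => memLp_const _) n]
  refine mul_le_mul_of_nonneg_left ?_ (sq_nonneg _)
  simpa using hρ n

/-- The normalized excess criterion converges in probability. -/
lemma tendstoInMeasure_excess (hε : ErrorCondition μ M.ε M.F σε)
    (hu : ErrorCondition μ M.u M.I σu) (ha₀ : Measurable M.a₀) {ini : Ω → ℝ}
    (hini : Measurable ini) (hθ₀ : 1 < M.θ₀) (hshort : 1 / 2 < M.θ₀ * (1 - M.β₀)) {θ : ℝ}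
    (hθ : 1 < θ) :
    TendstoInMeasure μ (fun (n : ℕ) ω => (Real.log n)⁻¹ *
      excess (fun s => M.u s ω) (fun t => M.gap ini θ t ω) n) atTop
      (fun _ => D σε M.β₀ θ M.θ₀) := by
  have hθ₀0 : M.θ₀ ≠ 0 := by linarith
  have hβ : 1 - M.β₀ ≠ 0 := by
    intro h
    rw [h, mul_zero] at hshort
    linarith
  have hθ2 : 1 / 2 < θ := by linarith
  set c := M.θ₀ * (1 - M.β₀) with hc
  set l := (M.θ₀ - θ) / M.θ₀ with hl
  set k := -(θ * l) with hk
  set w : ℕ → Ω → ℝ := fun t ω => l * state c M.θ₀ M.ε t ω + drift θ k c M.θ₀ M.ε t ω with hw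
  have hw2 : ∀ t, MemLp (w t) 2 μ := fun t =>
    ((hε.memLp_state c M.θ₀ t).const_mul l).add (hε.memLp_drift θ k c M.θ₀ t)
  have hwm : ∀ t, Measurable[M.I t] (w t) := fun t =>
    (((hε.measurable_state c M.θ₀ t).const_mul l).add
      (hε.measurable_drift θ k c M.θ₀ t)).mono (M.F_le_I hθ₀0 t) le_rfl
  obtain ⟨Cw, hCw0, hCw⟩ := exists_integral_tracking_sq_le hε hshort hθ2 k M.θ₀ l
  set κ := M.θ₀ ^ 2 * σε ^ 2 / (2 * c - 1) * (l ^ 2 + 2 * l * (k / (c + θ - 1))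
          + 2 * k / (2 * θ - 1) * (k / (c + θ - 1))) with hκ
  -- With k = -θl the bracket is l²·((2c-1)θ-(c-1))/((2θ-1)(c+θ-1)), and l² supplies the factor
  -- (θ-θ₀)²/θ₀².
  have hκD : κ = D σε M.β₀ θ M.θ₀ := by
    have h1 : c + θ - 1 ≠ 0 := by linarith
    have h2 : 2 * θ - 1 ≠ 0 := by linarith
    have h3 : 2 * c - 1 ≠ 0 := by linarith
    have h4 : 2 * (1 - M.β₀) * M.θ₀ - 1 = 2 * c - 1 := by rw [hc]; ring
    have h5 : (1 - M.β₀) * M.θ₀ = c := by rw [hc]; ring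
    rw [D, d, sigmaASq, h4, h5, hκ, hk, hl]
    rw [← hc]
    clear_value c
    field_simp
    ring
  -- the part started at zero
  have s1 : SmallL1 μ (fun n ω => ∑ t ∈ Finset.range n, w t ω ^ 2
      - κ * ∑ t ∈ Finset.range n, 1 / ((t : ℝ) + 1)) :=
    hε.smallL1_tracking_sq M.F_zero hshort hθ2 k M.θ₀ l
  have s2 : SmallL1 μ (fun n ω => ∑ t ∈ Finset.range n, w t ω * M.u (t + 1) ω) :=
    SmallL1.transform hu hwm hw2 hCw0 hCw
  -- the remainder
  obtain ⟨hρm, Cρ, hCρ0, -, hCρ⟩ := exists_integral_sq_sum_recur_mul_le hu hshort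
  obtain ⟨C, hC0, hC⟩ := exists_abs_excess_add_sub_le hshort hθ2 k l
  have b1 : SmallL1 μ (fun (_ : ℕ) (_ : Ω) => (1 : ℝ)) :=
    .of_bounded (fun _ => integrable_const _) (C := 1) fun n => by simp
  have b2 : SmallL1 μ (fun n ω => Real.sqrt (∑ t ∈ Finset.range n, w t ω ^ 2)) :=
    .sqrt (fun n => integrable_finsetSum _ fun t _ => (hw2 t).integrable_sq)
      (fun n ω => Finset.sum_nonneg fun _ _ => sq_nonneg _)
      (integral_sum_sq_le_log hw2 hCw0 hCw)
  have b3 : SmallL1 μ (fun n ω =>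
      ∑ t ∈ Finset.range n, recur c 1 (fun _ => 0) t * M.u (t + 1) ω) :=
    .of_integral_sq_le hρm (C := σu ^ 2 * Cρ) fun n => (hCρ n).trans <|
      le_mul_of_one_le_right (by positivity) (by linarith [Real.log_natCast_nonneg n])
  have b4 : SmallL1 μ (fun n ω =>
      Real.sqrt (∑ t ∈ Finset.range n, tailSum (fun s => M.u s ω) n t ^ 2)) :=
    .sqrt (fun n => (hu.integral_sum_tailSum_sq n).1)
      (fun n ω => Finset.sum_nonneg fun _ _ => sq_nonneg _) (C := σu ^ 2) fun n => by
        rw [(hu.integral_sum_tailSum_sq n).2]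
        exact mul_le_mul_of_nonneg_left (sum_one_div_le n) (sq_nonneg _)
  have hB := (((b1.add b2).add b3.abs).add b4).tendstoInMeasure
  have hcm : Measurable (M.centred 0) := ha₀.sub_const _
  have hgm : Measurable (M.gapDrift ini θ 0) := (ha₀.sub hini).sub (hcm.const_mul _)
  have hKm : Measurable fun ω => C * (1 + M.centred 0 ω ^ 2 + M.gapDrift ini θ 0 ω ^ 2) := by
    fun_prop
  -- A fixed random factor, with no moment bound, times a sequence that vanishes in probability
  -- after division by ln n.
  have hrem : TendstoInMeasure μ (fun (n : ℕ) ω => (Real.log n)⁻¹ *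
      (excess (fun s => M.u s ω) (fun t => M.gap ini θ t ω) n
        - excess (fun s => M.u s ω) (fun t => w t ω) n)) atTop (fun _ => (0 : ℝ)) := by
    refine tendstoInMeasure_zero_of_abs_le (tendstoInMeasure_zero_mul hKm hB) fun n ω => ?_
    have h1 := hC (fun s => M.u s ω) (fun t => w t ω) (M.centred 0 ω) (M.gapDrift ini θ 0 ω) n
    have h2 : (fun t => M.gap ini θ t ω) = fun t => w t ω + (l * (M.centred 0 ω
        * recur c 1 (fun _ => 0) t) + recur θ (M.gapDrift ini θ 0 ω)
          (fun s => k * (M.centred 0 ω * recur c 1 (fun _ => 0) s)) t) :=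
      funext fun t => M.gap_eq_zeroStart_add hθ₀0 hβ ini θ t ω
    rw [h2, abs_mul, mul_left_comm, abs_mul (Real.log n)⁻¹]
    exact mul_le_mul_of_nonneg_left (h1.trans (le_abs_self _)) (abs_nonneg _)
  have hlog := tendstoInMeasure_const_of_tendsto (μ := μ)
    (tendsto_inv_log_mul_sum_one_div.const_mul κ)
  have hall := tendstoInMeasure_add_const (tendstoInMeasure_add_const
    (s1.add (s2.const_mul 2)).tendstoInMeasure hlog) hrem
  rw [mul_one, zero_add, add_zero, hκD] at hall
  refine hall.congr_left fun n => ae_of_all _ fun ω => ?_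
  have e : excess (fun s => M.u s ω) (fun t => w t ω) n = ∑ t ∈ Finset.range n, w t ω ^ 2
      + 2 * ∑ t ∈ Finset.range n, w t ω * M.u (t + 1) ω := by
    simp only [excess, mul_comm]
  simp only [e]
  rw [← hκD]
  ring

/-- The Lipschitz constant of the criterion is `O_p(ln n)`. -/
lemma isBigOpOne_envelope (hε : ErrorCondition μ M.ε M.F σε)
    (hu : ErrorCondition μ M.u M.I σu) (ha₀ : Measurable M.a₀) {ini : Ω → ℝ}
    (hini : Measurable ini) (hθ₀ : 1 < M.θ₀) (hshort : 1 / 2 < M.θ₀ * (1 - M.β₀)) {A : ℝ}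
    (hA : 0 ≤ A) :
    IsBigOpOne μ (fun n ω => (Real.log n)⁻¹ * (A * envelope (fun s => M.u s ω)
      (fun t => M.centred t ω) (M.a₀ ω - ini ω) n)) := by
  have hθ₀0 : M.θ₀ ≠ 0 := by linarith
  have hβ : 1 - M.β₀ ≠ 0 := by
    intro h
    rw [h, mul_zero] at hshort
    linarith
  set c := M.θ₀ * (1 - M.β₀) with hc
  set x := state c M.θ₀ M.ε with hx
  set ρ := recur c 1 (fun _ => 0) with hρ
  have hx2 : ∀ t, MemLp (x t) 2 μ := hε.memLp_state c M.θ₀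
  have hxm : ∀ t, Measurable[M.I t] (x t) := fun t =>
    (hε.measurable_state c M.θ₀ t).mono (M.F_le_I hθ₀0 t) le_rfl
  obtain ⟨Cx, hCx0, hCx⟩ := hε.exists_integral_state_sq_le hshort M.θ₀
  obtain ⟨hρm, Cρ, hCρ0, hρsum, hCρ⟩ := exists_integral_sq_sum_recur_mul_le hu hshort
  -- K gathers what depends on the initial values only and is divided by ln n without any moment
  -- bound; the sums Z₁ to Z₄ have means O(ln n).
  set K : Ω → ℝ := fun ω => A * ((M.a₀ ω - ini ω) ^ 2 + (2 + 2 * Cρ) * M.centred 0 ω ^ 2 + 1)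
    with hK
  have hcm : Measurable (M.centred 0) := ha₀.sub_const _
  have hKm : Measurable K := by fun_prop
  set Z₁ : ℕ → Ω → ℝ := fun n ω => ∑ t ∈ Finset.range n, x t ω ^ 2 with hZ₁
  set Z₂ : ℕ → Ω → ℝ := fun n ω =>
    ∑ t ∈ Finset.range n, tailSum (fun s => M.u s ω) n t ^ 2 with hZ₂
  set Z₃ : ℕ → Ω → ℝ := fun n ω => (∑ t ∈ Finset.range n, ρ t * M.u (t + 1) ω) ^ 2 with hZ₃
  set Z₄ : ℕ → Ω → ℝ := fun n ω => (∑ t ∈ Finset.range n, x t ω * M.u (t + 1) ω) ^ 2 with hZ₄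
  have hi₁ : ∀ n, Integrable (Z₁ n) μ := fun n =>
    integrable_finsetSum _ fun t _ => (hx2 t).integrable_sq
  have hi₂ : ∀ n, Integrable (Z₂ n) μ := fun n => (hu.integral_sum_tailSum_sq n).1
  have hi₃ : ∀ n, Integrable (Z₃ n) μ := fun n => (hρm n).integrable_sq
  have hi₄ : ∀ n, Integrable (Z₄ n) μ := fun n => (hu.memLp_sum hxm hx2 n).integrable_sq
  have h₁ : ∀ n : ℕ, ∫ ω, Z₁ n ω ∂μ ≤ Cx * (1 + Real.log n) :=
    integral_sum_sq_le_log hx2 hCx0 hCx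
  have h₂ : ∀ n : ℕ, ∫ ω, Z₂ n ω ∂μ ≤ σu ^ 2 * (1 + Real.log n) := fun n => by
    simp only [hZ₂]
    rw [(hu.integral_sum_tailSum_sq n).2]
    exact mul_le_mul_of_nonneg_left (sum_one_div_le n) (sq_nonneg _)
  have h₃ : ∀ n : ℕ, ∫ ω, Z₃ n ω ∂μ ≤ σu ^ 2 * Cρ * (1 + Real.log n) := fun n =>
    (hCρ n).trans <| le_mul_of_one_le_right (by positivity)
      (by linarith [Real.log_natCast_nonneg n])
  have h₄ : ∀ n : ℕ, ∫ ω, Z₄ n ω ∂μ ≤ σu ^ 2 * (Cx * (1 + Real.log n)) := fun n => by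
    simp only [hZ₄]
    rw [hu.integral_sq_sum hxm hx2, ← integral_finsetSum _ fun t _ => (hx2 t).integrable_sq]
    exact mul_le_mul_of_nonneg_left (h₁ n) (sq_nonneg _)
  have p₁ : ∀ n ω, 0 ≤ Z₁ n ω := fun n ω => Finset.sum_nonneg fun _ _ => sq_nonneg _
  have p₂ : ∀ n ω, 0 ≤ Z₂ n ω := fun n ω => Finset.sum_nonneg fun _ _ => sq_nonneg _
  have p₃ : ∀ n ω, 0 ≤ Z₃ n ω := fun n ω => sq_nonneg _
  have p₄ : ∀ n ω, 0 ≤ Z₄ n ω := fun n ω => sq_nonneg _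
  have hs : ∀ n, Integrable (fun ω => A * (2 * Z₁ n ω + Z₂ n ω + Z₃ n ω + Z₄ n ω)) μ :=
    fun n => (((((hi₁ n).const_mul 2).add (hi₂ n)).add (hi₃ n)).add (hi₄ n)).const_mul A
  refine isBigOpOne_of_abs_le hKm hs
    (C := A * (2 * Cx + σu ^ 2 + σu ^ 2 * Cρ + σu ^ 2 * Cx)) (by positivity) (fun n => ?_)
    fun n ω => ?_
  · have hnn : ∀ ω, 0 ≤ A * (2 * Z₁ n ω + Z₂ n ω + Z₃ n ω + Z₄ n ω) := fun ω => by
      have := p₁ n ω; have := p₂ n ω; have := p₃ n ω; have := p₄ n ω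
      positivity
    simp_rw [abs_of_nonneg (hnn _)]
    have j₂ : Integrable (fun ω => 2 * Z₁ n ω + Z₂ n ω) μ := ((hi₁ n).const_mul 2).add (hi₂ n)
    have j₃ : Integrable (fun ω => 2 * Z₁ n ω + Z₂ n ω + Z₃ n ω) μ := j₂.add (hi₃ n)
    rw [integral_const_mul, integral_add j₃ (hi₄ n), integral_add j₂ (hi₃ n),
      integral_add ((hi₁ n).const_mul 2) (hi₂ n), integral_const_mul, mul_assoc]
    refine mul_le_mul_of_nonneg_left ?_ hA
    linarith [h₁ n, h₂ n, h₃ n, h₄ n]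
  · have henv0 : 0 ≤ envelope (fun s => M.u s ω) (fun t => M.centred t ω) (M.a₀ ω - ini ω) n := by
      unfold envelope
      positivity
    rw [abs_of_nonneg (mul_nonneg hA henv0)]
    have e1 : ∑ t ∈ Finset.range n, M.centred t ω ^ 2 ≤
        2 * (M.centred 0 ω ^ 2 * Cρ) + 2 * Z₁ n ω := by
      have h5 := sum_add_sq_le (fun t => M.centred 0 ω * ρ t) (fun t => x t ω) n
      have h6 : ∑ t ∈ Finset.range n, (M.centred 0 ω * ρ t) ^ 2 ≤ M.centred 0 ω ^ 2 * Cρ := by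
        simp_rw [mul_pow]
        rw [← Finset.mul_sum]
        exact mul_le_mul_of_nonneg_left (hρsum n) (sq_nonneg _)
      have h7 : ∑ t ∈ Finset.range n, M.centred t ω ^ 2 =
          ∑ t ∈ Finset.range n, (M.centred 0 ω * ρ t + x t ω) ^ 2 :=
        Finset.sum_congr rfl fun t _ => by rw [M.centred_eq hβ t ω]
      rw [h7]
      linarith
    have e2 : |∑ t ∈ Finset.range n, M.u (t + 1) ω * M.centred t ω| ≤
        M.centred 0 ω ^ 2 + 1 + Z₃ n ω + Z₄ n ω := by
      have h7 : ∑ t ∈ Finset.range n, M.u (t + 1) ω * M.centred t ω =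
          M.centred 0 ω * ∑ t ∈ Finset.range n, ρ t * M.u (t + 1) ω
            + ∑ t ∈ Finset.range n, x t ω * M.u (t + 1) ω := by
        rw [Finset.mul_sum, ← Finset.sum_add_distrib]
        exact Finset.sum_congr rfl fun t _ => by rw [M.centred_eq hβ t ω]; ring
      rw [h7]
      simp only [hZ₃, hZ₄]
      generalize ∑ t ∈ Finset.range n, ρ t * M.u (t + 1) ω = r
      generalize ∑ t ∈ Finset.range n, x t ω * M.u (t + 1) ω = s
      generalize M.centred 0 ω = q
      rw [abs_le]
      constructor <;>
        nlinarith [sq_nonneg (q + r), sq_nonneg (q - r), sq_nonneg (s + 1), sq_nonneg (s - 1)]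
    have e3 : envelope (fun s => M.u s ω) (fun t => M.centred t ω) (M.a₀ ω - ini ω) n ≤
        ((M.a₀ ω - ini ω) ^ 2 + (2 + 2 * Cρ) * M.centred 0 ω ^ 2 + 1)
          + (2 * Z₁ n ω + Z₂ n ω + Z₃ n ω + Z₄ n ω) := by
      unfold envelope
      linarith
    have := mul_le_mul_of_nonneg_left e3 hA
    rw [mul_add] at this
    exact this

end Probability

end Model

/-! ### The limit criterion -/

lemma d_denominators_pos {θ₀ β₀ θ : ℝ} (hshort : 1 / 2 < θ₀ * (1 - β₀)) (hθ : 1 < θ) :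
    0 < 2 * (1 - β₀) * θ₀ - 1 ∧ 0 < (2 * θ - 1) * (θ₀ * (1 - β₀) + θ - 1) :=
  ⟨by nlinarith, mul_pos (by linarith) (by linarith)⟩

/-- The numerator increases in θ and equals c = θ₀(1-β₀) at θ = 1, so it is positive for θ > 1. -/
lemma d_pos {σ θ₀ β₀ θ : ℝ} (hσ : 0 < σ) (hθ₀ : 0 < θ₀) (hshort : 1 / 2 < θ₀ * (1 - β₀))
    (hθ : 1 < θ) : 0 < d σ β₀ θ θ₀ := by
  obtain ⟨h1, h2⟩ := d_denominators_pos hshort hθ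
  have h3 : 0 < (2 * (1 - β₀) * θ₀ - 1) * θ - ((1 - β₀) * θ₀ - 1) := by nlinarith
  rw [d, sigmaASq]
  positivity

lemma D_pos {σ θ₀ β₀ θ : ℝ} (hσ : 0 < σ) (hθ₀ : 0 < θ₀) (hshort : 1 / 2 < θ₀ * (1 - β₀))
    (hθ : 1 < θ) (hne : θ ≠ θ₀) : 0 < D σ β₀ θ θ₀ :=
  mul_pos (sq_pos_of_ne_zero (sub_ne_zero.2 hne)) (d_pos hσ hθ₀ hshort hθ)

lemma D_self (σ θ₀ β₀ : ℝ) : D σ β₀ θ₀ θ₀ = 0 := by simp [D]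

lemma continuousOn_D (σ : ℝ) {θ₀ β₀ lo hi : ℝ} (hshort : 1 / 2 < θ₀ * (1 - β₀)) (hlo : 1 < lo) :
    ContinuousOn (fun θ => D σ β₀ θ θ₀) (Icc lo hi) := by
  unfold D d
  refine ContinuousOn.mul (by fun_prop) (continuousOn_const.mul
    (ContinuousOn.div (by fun_prop) (by fun_prop) fun θ hθ => ?_))
  exact (d_denominators_pos hshort (hlo.trans_le hθ.1)).2.ne'

end GainLearning

/-! ### The main theorem -/

theorem proposition1 {Ω : Type*} [MeasurableSpace Ω] (μ : Measure Ω) [IsProbabilityMeasure μ]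
    (M : GainLearning.Model Ω) (θlo θhi σε σu : ℝ)
    -- the true gain is interior, the gain bounds, and the short-memory condition
    (hθ₀ : M.θ₀ ∈ Ioo θlo θhi) (hθlo : 1 < θlo) (hshort : 1 / 2 < M.θ₀ * (1 - M.β₀))
    -- the errors and the initial value
    (hσε : 0 < σε)
    (hε : GainLearning.ErrorCondition μ M.ε M.F σε)
    (hu : GainLearning.ErrorCondition μ M.u M.I σu)
    (ha₀ : GainLearning.InitialCondition μ M)
    -- the candidate initial value used in the criterion: a constant, the true one, or any other
    (ini : Ω → ℝ) (hini : Measurable ini) :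
    -- pointwise convergence in probability to the limit criterion
    (∀ θ ∈ Icc θlo θhi,
      TendstoInMeasure μ (fun (n : ℕ) ω => (Real.log n)⁻¹ * M.Dn ini n θ ω) atTop
        (fun _ => GainLearning.D σε M.β₀ θ M.θ₀)) ∧
    -- the limit criterion is continuous and uniquely minimized at the true gain
    ContinuousOn (fun θ => GainLearning.D σε M.β₀ θ M.θ₀) (Icc θlo θhi) ∧
    (∀ θ ∈ Icc θlo θhi, θ ≠ M.θ₀ →
      GainLearning.D σε M.β₀ M.θ₀ M.θ₀ < GainLearning.D σε M.β₀ θ M.θ₀) ∧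
    -- stochastic Lipschitz condition
    (∃ (h : ℝ → ℝ) (L : ℕ → Ω → ℝ),
      Tendsto h (𝓝[≥] 0) (𝓝 0) ∧
      (∀ n, Measurable (L n)) ∧
      GainLearning.IsBigOpOne μ (fun n ω => (Real.log n)⁻¹ * L n ω) ∧
      ∀ n, ∀ θ₁ ∈ Icc θlo θhi, ∀ θ₂ ∈ Icc θlo θhi, ∀ ω,
        |M.Dn ini n θ₁ ω - M.Dn ini n θ₂ ω| ≤ h |θ₁ - θ₂| * L n ω) ∧
    -- weak consistency of the nonlinear least-squares estimator
    (∀ θhat : ℕ → Ω → ℝ,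
      (∀ n ω, θhat n ω ∈ Icc θlo θhi ∧
        IsMinOn (fun θ => M.Q ini n θ ω) (Icc θlo θhi) (θhat n ω)) →
      TendstoInMeasure μ θhat atTop (fun _ => M.θ₀)) := by
  obtain ⟨hlo₀, hhi₀⟩ := hθ₀
  have hθ₀1 : 1 < M.θ₀ := hθlo.trans hlo₀
  have hθ₀0 : M.θ₀ ≠ 0 := by linarith
  have hβ : 1 - M.β₀ ≠ 0 := by
    intro h
    rw [h, mul_zero] at hshort
    linarith
  have hpt : ∀ θ ∈ Icc θlo θhi,
      TendstoInMeasure μ (fun (n : ℕ) ω => (Real.log n)⁻¹ * M.Dn ini n θ ω) atTop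
        (fun _ => GainLearning.D σε M.β₀ θ M.θ₀) := by
    intro θ hθ
    have h1 := GainLearning.Model.tendstoInMeasure_excess hε hu ha₀.measurable hini hθ₀1 hshort
      (hθlo.trans_le hθ.1)
    -- At the true gain the excess need not vanish, since the initial values may differ, but its
    -- normalized limit is 0.
    have h2 := GainLearning.Model.tendstoInMeasure_excess hε hu ha₀.measurable hini hθ₀1 hshort
      hθ₀1
    rw [GainLearning.D_self] at h2
    have h3 := GainLearning.tendstoInMeasure_add_const h1
      (GainLearning.tendstoInMeasure_zero_mul (K := fun _ => -1) measurable_const h2)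
    rw [add_zero] at h3
    refine h3.congr_left fun n => ae_of_all _ fun ω => ?_
    simp only [GainLearning.Model.Dn_eq]
    ring
  have hpos : ∀ θ ∈ Icc θlo θhi, θ ≠ M.θ₀ → 0 < GainLearning.D σε M.β₀ θ M.θ₀ := fun θ hθ hne =>
    GainLearning.D_pos hσε (by linarith) hshort (hθlo.trans_le hθ.1) hne
  have hcont := GainLearning.continuousOn_D σε (hi := θhi) hshort hθlo
  obtain ⟨C, hC0, hC⟩ := GainLearning.exists_abs_excess_sub_le hθlo ⟨hlo₀, hhi₀⟩
  set L : ℕ → Ω → ℝ := fun n ω => C * GainLearning.envelope (fun s => M.u s ω)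
    (fun t => M.centred t ω) (M.a₀ ω - ini ω) n with hL
  have hLm : ∀ n, Measurable (L n) := fun n =>
    (GainLearning.Model.measurable_envelope hε hu ha₀.measurable hini n).const_mul C
  have hLO : GainLearning.IsBigOpOne μ (fun n ω => (Real.log n)⁻¹ * L n ω) :=
    GainLearning.Model.isBigOpOne_envelope hε hu ha₀.measurable hini hθ₀1 hshort hC0
  have hlip : ∀ n, ∀ θ₁ ∈ Icc θlo θhi, ∀ θ₂ ∈ Icc θlo θhi, ∀ ω,
      |M.Dn ini n θ₁ ω - M.Dn ini n θ₂ ω| ≤ |θ₁ - θ₂| * L n ω := by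
    intro n θ₁ h₁ θ₂ h₂ ω
    have h := hC (fun s => M.u s ω) (fun t => M.centred t ω) (M.a₀ ω - ini ω)
      (fun θ t => M.gapDrift ini θ t ω) (fun θ => M.gapDrift_zero ini θ ω)
      (fun θ t => M.gapDrift_succ hθ₀0 hβ ini θ t ω) n θ₁ h₁ θ₂ h₂
    simp_rw [← M.gap_eq] at h
    rw [M.Dn_eq, M.Dn_eq, sub_sub_sub_cancel_right]
    exact h
  refine ⟨hpt, hcont, fun θ hθ hne => ?_, ⟨fun r => r, L, ?_, hLm, hLO, hlip⟩, fun θhat hhat => ?_⟩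
  · rw [GainLearning.D_self]
    exact hpos θ hθ hne
  · exact tendsto_id.mono_left nhdsWithin_le_nhds
  · refine GainLearning.tendstoInMeasure_argmin hpt hcont hpos hLO hlip
      (fun n ω => (hhat n ω).1) fun n ω => ?_
    -- Comparison with the admissible gain θ₀ shows that D_n is nonpositive at the minimizer.
    have h := (hhat n ω).2 (show M.θ₀ ∈ Icc θlo θhi from ⟨hlo₀.le, hhi₀.le⟩)
    simpa [GainLearning.Model.Dn] using h
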